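/- A name of a point $x\in\mathbb{R}^n$ is a function $\gamma$ from $\mathbb{N}$ to $n$-tuples of dyadic rationals with $|\gamma(i)_j-x_j|<2^{-i}$ for all $i,j$. A function $f:\subseteq\mathbb{R}^n\to\mathbb{R}$ (possibly partial) is Type 2 computable if some function-oracle machine $M$ computes it: for every $x\in\operatorname{dom}(f)$, every name $\gamma$ of $x$ and every $i\in\mathbb{N}$, $M^{\gamma}(i)$ halts and outputs a dyadic rational with $|M^\gamma(i)-f(x)|<2^{-i}$. Let $\mathcal{F}$ be any collection of Type 2 computable real functions (of various arities). $\mathcal{L}_{\mathcal{F}}$-terms are built from variables by the functions in $\mathcal{F}$, rational constants, unary negation, addition and absolute value (the latter four always belong to the language). Bounded $\mathcal{L}_{\mathcal{F}}$-formulas are built from atoms $t>0$ and $t\ge 0$ by $\wedge$, $\vee$ and the bounded quantifiers $\exists^{[u,v]}x$, $\forall^{[u,v]}x$, where $u,v$ are terms not containing $x$ (the variables quantified further outside may occur in them); the quantified variable ranges over the closed interval with end points $u$ and $v$, i.e. $[u,v]$ is read as $[v,u]$ when $v<u$. (Prenex sentences $Q_1^{[u_1,v_1]}x_1\cdots Q_n^{[u_n,v_n]}x_n.\,\psi$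 with $\psi$ quantifier-free are a special case.) A bounded $\mathcal{L}_{\mathcal{F}}$-sentence is such a formula without free variables; it is understood that all its terms are defined whenever the quantified variables take values in their ranges, which is automatic if all functions in $\mathcal{F}$ are total. For a rational $\delta>0$, the $\delta$-strengthening $\varphi^{+\delta}$ is obtained from $\varphi$ by replacing each atom $t>0$ by $t>\delta$ and each atom $t\ge0$ by $t\ge\delta$, leaving the bounds on the quantifiers unchanged. Theorem. There is an algorithm which, given any bounded $\mathcal{L}_{\mathcal{F}}$-sentence $\varphi$ (written as a finite string in which each symbol for a function in $\mathcal{F}$ is given by its arity and a program of an oracle machine computing it) and any rational $\delta>0$, halts and correctly returns one of the following two answers: "$\varphi$ is true", or "$\varphi^{+\delta}$ is false". If both are correct, either may be returned. Moreover, one algorithm serves for all collections $\mathcal{F}$. -/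

import Mathlib

open Encodable

universe u

/-! ### Dyadic numbers, names, oracle machines, Type 2 computability -/

/-- Finite representation `(m, k)` of the dyadic rational `m / 2 ^ k`. -/
abbrev DyadicRep : Type := ℤ × ℕ

/-- The dyadic rational number represented by `(m, k)`, as a real number. -/
noncomputable def DyadicRep.val (d : DyadicRep) : ℝ := (d.1 : ℝ) / 2 ^ d.2

/-- `γ` is a name of `x ∈ ℝⁿ`: for every `i`, `γ i` is a tuple of `n` dyadic rationals that
approximates each coordinate of `x` with error less than `2⁻ⁱ`. -/
def IsName {n : ℕ} (γ : ℕ → Fin n → DyadicRep) (x : Fin n → ℝ) : Prop :=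
  ∀ i j, |(γ i j).val - x j| < ((2 : ℝ) ^ i)⁻¹

/-- Function-oracle machines. An oracle machine is given by an ordinary program `c`. What the
machine does between two consecutive oracle queries is an ordinary computation, determined by the
input `i` and by the list `h` of the oracle answers received so far; its result is the next action:
either `Sum.inl q` ("ask the oracle for its value at `q`") or `Sum.inr d` ("halt with output `d`").
`OracleRun c γ i h d` says that the machine `c` with oracle `γ` and input `i`, after having received
the answers `h`, asks finitely many further queries and then halts with output `d`. -/
inductive OracleRun {n : ℕ} (c : Nat.Partrec.Code) (γ : ℕ → Fin n → DyadicRep) (i : ℕ) :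
    List (List DyadicRep) → DyadicRep → Prop
  | halt {h : List (List DyadicRep)} {d : DyadicRep} :
      encode (Sum.inr d : ℕ ⊕ DyadicRep) ∈ c.eval (encode (i, h)) →
      OracleRun c γ i h d
  | query {h : List (List DyadicRep)} {q : ℕ} {d : DyadicRep} :
      encode (Sum.inl q : ℕ ⊕ DyadicRep) ∈ c.eval (encode (i, h)) →
      OracleRun c γ i (h ++ [List.ofFn (γ q)]) d →
      OracleRun c γ i h d

/-- The oracle machine `c` computes the (partial) real function `f` with domain `D ⊆ ℝⁿ`: on every
name of every point `x` of `D` as an oracle, and on every input `i`, it halts and outputs a dyadic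
rational at distance less than `2⁻ⁱ` from `f x`. -/
def Computes {n : ℕ} (c : Nat.Partrec.Code) (D : Set (Fin n → ℝ)) (f : (Fin n → ℝ) → ℝ) : Prop :=
  ∀ x ∈ D, ∀ γ : ℕ → Fin n → DyadicRep, IsName γ x →
    ∀ i : ℕ, ∃ d : DyadicRep, OracleRun c γ i [] d ∧ |d.val - f x| < ((2 : ℝ) ^ i)⁻¹

/-! ### The language of a collection of real functions -/

/-- A collection of (possibly partial) real functions of several variables, with function symbols
denoting them. Constants are functions of arity `0`; a total function has `dom s = Set.univ`;
the values of `fn s` outside `dom s` are irrelevant. -/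
structure FunCollection where
  /-- the function symbols -/
  Symbol : Type u
  /-- the number of arguments -/
  arity : Symbol → ℕ
  /-- the domain of the function -/
  dom : (s : Symbol) → Set (Fin (arity s) → ℝ)
  /-- the function -/
  fn : (s : Symbol) → (Fin (arity s) → ℝ) → ℝ

namespace FunCollection

/-- Terms with variables `x₀, …, x_{k-1}`. Rational constants, unary negation, addition and
absolute value always belong to the language. -/
inductive Term (F : FunCollection.{u}) (k : ℕ) : Type u
  | var : Fin k → Term F k
  | const : ℚ → Term F k
  | neg : Term F k → Term F k
  | add : Term F k → Term F k → Term F k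
  | abs : Term F k → Term F k
  | app : (s : F.Symbol) → (Fin (F.arity s) → Term F k) → Term F k

/-- Bounded formulas with free variables among `x₀, …, x_{k-1}`: `t > 0`, `t ≥ 0`, conjunctions,
disjunctions, and the bounded quantifications `∃^[u,v] x_k. φ` and `∀^[u,v] x_k. φ`, where the terms
`u`, `v` contain only variables among `x₀, …, x_{k-1}`. Prenex formulas are a special case. -/
inductive Formula (F : FunCollection.{u}) : ℕ → Type u
  | pos {k : ℕ} : Term F k → Formula F k
  | nonneg {k : ℕ} : Term F k → Formula F k
  | and {k : ℕ} : Formula F k → Formula F k → Formula F k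
  | or {k : ℕ} : Formula F k → Formula F k → Formula F k
  | ex {k : ℕ} : (u v : Term F k) → Formula F (k + 1) → Formula F k
  | all {k : ℕ} : (u v : Term F k) → Formula F (k + 1) → Formula F k

/-- Bounded sentences: no free variables. -/
abbrev Sentence (F : FunCollection.{u}) : Type u := Formula F 0

variable {F : FunCollection.{u}}

/-- The value of a term. -/
noncomputable def Term.eval {k : ℕ} (x : Fin k → ℝ) : Term F k → ℝ
  | var i => x i
  | const q => (q : ℝ)
  | neg t => -t.eval x
  | add t t' => t.eval x + t'.eval x
  | abs t => |t.eval x|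
  | app s ts => F.fn s fun i => (ts i).eval x

/-- The term is defined at `x`: functions are only applied to arguments in their domains. -/
def Term.Defined {k : ℕ} (x : Fin k → ℝ) : Term F k → Prop
  | var _ => True
  | const _ => True
  | neg t => t.Defined x
  | add t t' => t.Defined x ∧ t'.Defined x
  | abs t => t.Defined x
  | app s ts => (∀ i, (ts i).Defined x) ∧ (fun i => (ts i).eval x) ∈ F.dom s

/-- Truth of a formula at `x`. A quantifier with bound `[u, v]` ranges over the closed interval with
end points `u` and `v`, which is read as `[v, u]` when `v < u`. -/
def Formula.Holds : {k : ℕ} → Formula F k → (Fin k → ℝ) → Prop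
  | _, pos t, x => t.eval x > 0
  | _, nonneg t, x => t.eval x ≥ 0
  | _, and φ ψ, x => φ.Holds x ∧ ψ.Holds x
  | _, or φ ψ, x => φ.Holds x ∨ ψ.Holds x
  | _, ex u v φ, x => ∃ y ∈ Set.uIcc (u.eval x) (v.eval x), φ.Holds (Fin.snoc x y)
  | _, all u v φ, x => ∀ y ∈ Set.uIcc (u.eval x) (v.eval x), φ.Holds (Fin.snoc x y)

/-- All terms of the formula are defined whenever each quantified variable takes a value in its
range. -/
def Formula.Defined : {k : ℕ} → Formula F k → (Fin k → ℝ) → Prop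
  | _, pos t, x => t.Defined x
  | _, nonneg t, x => t.Defined x
  | _, and φ ψ, x => φ.Defined x ∧ ψ.Defined x
  | _, or φ ψ, x => φ.Defined x ∧ ψ.Defined x
  | _, ex u v φ, x => u.Defined x ∧ v.Defined x ∧
      ∀ y ∈ Set.uIcc (u.eval x) (v.eval x), φ.Defined (Fin.snoc x y)
  | _, all u v φ, x => u.Defined x ∧ v.Defined x ∧
      ∀ y ∈ Set.uIcc (u.eval x) (v.eval x), φ.Defined (Fin.snoc x y)

/-- The sentence is true. -/
def Formula.IsTrue (φ : Sentence F) : Prop := φ.Holds Fin.elim0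

/-- All terms of the sentence are defined on the ranges of the quantified variables. -/
def Formula.WellDefined (φ : Sentence F) : Prop := φ.Defined Fin.elim0

/-- Over total functions every term is defined. -/
theorem Term.defined_of_total (hF : ∀ s, F.dom s = Set.univ) {k : ℕ} (t : Term F k)
    (x : Fin k → ℝ) : t.Defined x := by
  induction t with
  | var i => trivial
  | const q => trivial
  | neg t ih => exact ih
  | add t t' ih ih' => exact ⟨ih, ih'⟩
  | abs t ih => exact ih
  | app s ts ih => exact ⟨ih, by rw [hF s]; trivial⟩

/-- Over total functions every formula is defined. -/
theorem Formula.defined_of_total (hF : ∀ s, F.dom s = Set.univ) {k : ℕ} (φ : Formula F k)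
    (x : Fin k → ℝ) : φ.Defined x := by
  induction φ with
  | pos t => exact t.defined_of_total hF x
  | nonneg t => exact t.defined_of_total hF x
  | and φ ψ ih ih' => exact ⟨ih x, ih' x⟩
  | or φ ψ ih ih' => exact ⟨ih x, ih' x⟩
  | ex u v φ ih =>
    exact ⟨u.defined_of_total hF x, v.defined_of_total hF x, fun y _ => ih (Fin.snoc x y)⟩
  | all u v φ ih =>
    exact ⟨u.defined_of_total hF x, v.defined_of_total hF x, fun y _ => ih (Fin.snoc x y)⟩

/-- The `δ`-strengthening: each atom `t > 0` becomes `t > δ` and each atom `t ≥ 0` becomes `t ≥ δ`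
(that is, `t + (-δ) > 0` and `t + (-δ) ≥ 0`); the bounds on the quantifiers do not change. -/
def Formula.strengthen (δ : ℚ) : {k : ℕ} → Formula F k → Formula F k
  | _, pos t => pos (t.add (Term.neg (Term.const δ)))
  | _, nonneg t => nonneg (t.add (Term.neg (Term.const δ)))
  | _, and φ ψ => and (φ.strengthen δ) (ψ.strengthen δ)
  | _, or φ ψ => or (φ.strengthen δ) (ψ.strengthen δ)
  | _, ex u v φ => ex u v (φ.strengthen δ)
  | _, all u v φ => all u v (φ.strengthen δ)

end FunCollection

/-! ### Sentences as inputs of algorithms -/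

/-- Tokens: a tag, which says what kind of symbol the token is, and a payload. -/
abbrev Token : Type := ℕ × ℕ

namespace FunCollection

variable {F : FunCollection.{u}}

/-- A term in prefix notation. A rational constant is written down by its numerator and denominator,
a function symbol `s` by its arity and (the code of) the oracle machine `prog s` computing it. -/
def Term.code (prog : F.Symbol → Nat.Partrec.Code) {k : ℕ} : Term F k → List Token
  | var i => [(0, (i : ℕ))]
  | const q => [(1, encode ((q.num, q.den) : ℤ × ℕ))]
  | neg t => (2, 0) :: t.code prog
  | add t t' => (3, 0) :: (t.code prog ++ t'.code prog)
  | abs t => (4, 0) :: t.code prog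
  | app s ts => (5, encode (F.arity s, prog s)) :: (List.ofFn fun i => (ts i).code prog).flatten

/-- A bounded formula in prefix notation. -/
def Formula.code (prog : F.Symbol → Nat.Partrec.Code) : {k : ℕ} → Formula F k → List Token
  | _, pos t => (6, 0) :: t.code prog
  | _, nonneg t => (7, 0) :: t.code prog
  | _, and φ ψ => (8, 0) :: (φ.code prog ++ ψ.code prog)
  | _, or φ ψ => (9, 0) :: (φ.code prog ++ ψ.code prog)
  | _, ex u v φ => (10, 0) :: (u.code prog ++ v.code prog ++ φ.code prog)
  | _, all u v φ => (11, 0) :: (u.code prog ++ v.code prog ++ φ.code prog)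

end FunCollection

/-! ### Primitive recursive functions: `fun_prop` setup -/

/-! The algorithm searches in parallel for two kinds of finite certificate: one proving that φ is
true, one proving that its δ-strengthening is false. What has to be shown is that certificates are
semidecidable, that they are sound, and that at least one of the two always exists. No modulus of
continuity or bound on the search is ever computed.

Existence rests on a dichotomy (`Formula.strong_or_strong`). Every real y satisfies 0 < y or y < δ,
because δ > 0. Pushing this through the connectives and quantifiers by de Morgan duality shows that
either φ holds with all the atoms it uses strictly positive, or φ is refuted with all the atoms it
uses strictly below δ. Both alternatives are open conditions, so interval arithmetic can verify
them.

A certificate evaluates terms on boxes of dyadic intervals. To enclose f on a box, it exhibits a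
finite table of oracle answers and a halting run of the machine for f on that table, where each
entry is accurate for all points of the box at once. Soundness (`TableRun.sound`): for every point
of the box in dom f the table extends to a name of that point, and the machine is deterministic, so
its output is correct there. Completeness (`Term.eventually_encloses`): a run on a fixed name of one
point reads only finitely many entries, and the strict inequalities in the definition of a name
leave room for the same table to serve all small boxes nearby.

A quantifier over [u,v] is treated by writing y = u + s(v - u) with s in [0,1] and cutting [0,1]
into 2^K cells; this also handles v < u and inexactly known u, v. Where all instances are needed,
every cell is certified, and compactness of the range gives one mesh that works (`BoxNear.uniform`).
Where one instance suffices, one grid point close to a witness is enough, by openness.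

The input is a raw string, so a certificate also parses it: the judgements carry the unread
remainder of the string, and soundness includes unique readability. A subformula whose truth does
not matter is certified in mode `none`, which only determines where it ends. Certificates are given
by inductive definitions with semidecidable rules, hence are themselves semidecidable
(`Derivable.semiDec`). They mention only strings and programs, so one algorithm serves all
collections. -/

section PrimrecFunProp

variable {α β γ σ : Type*} [Primcodable α] [Primcodable β] [Primcodable γ] [Primcodable σ]

attribute [fun_prop] Primrec PrimrecPred
attribute [fun_prop] Primrec.const Primrec.comp Primrec.pair PrimrecPred.and PrimrecPred.or

namespace Primrec

@[fun_prop]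
theorem fun_id : Primrec (fun x : α => x) := Primrec.id

@[fun_prop]
theorem fun_fst {f : α → β × γ} (hf : Primrec f) : Primrec fun x => (f x).1 :=
  Primrec.fst.comp hf

@[fun_prop]
theorem fun_snd {f : α → β × γ} (hf : Primrec f) : Primrec fun x => (f x).2 :=
  Primrec.snd.comp hf

@[fun_prop]
theorem fun_cons {f : α → β} {g : α → List β} (hf : Primrec f) (hg : Primrec g) :
    Primrec fun x => f x :: g x :=
  Primrec.list_cons.comp hf hg

@[fun_prop]
theorem fun_append {f g : α → List β} (hf : Primrec f) (hg : Primrec g) :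
    Primrec fun x => f x ++ g x :=
  Primrec.list_append.comp hf hg

@[fun_prop]
theorem fun_length {f : α → List β} (hf : Primrec f) : Primrec fun x => (f x).length :=
  Primrec.list_length.comp hf

@[fun_prop]
theorem fun_getElem? {f : α → List β} {g : α → ℕ} (hf : Primrec f) (hg : Primrec g) :
    Primrec fun x => (f x)[g x]? :=
  Primrec.list_getElem?.comp hf hg

@[fun_prop]
theorem fun_range {f : α → ℕ} (hf : Primrec f) : Primrec fun x => List.range (f x) :=
  Primrec.list_range.comp hf

@[fun_prop]
theorem fun_encode {f : α → β} (hf : Primrec f) : Primrec fun x => encode (f x) :=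
  Primrec.encode.comp hf

@[fun_prop]
theorem fun_some {f : α → β} (hf : Primrec f) : Primrec fun x => some (f x) :=
  Primrec.option_some.comp hf

@[fun_prop]
theorem fun_inl {f : α → β} (hf : Primrec f) : Primrec fun x => (Sum.inl (f x) : β ⊕ γ) :=
  Primrec.sumInl.comp hf

@[fun_prop]
theorem fun_inr {f : α → γ} (hf : Primrec f) : Primrec fun x => (Sum.inr (f x) : β ⊕ γ) :=
  Primrec.sumInr.comp hf

@[fun_prop]
theorem fun_nat_add {f g : α → ℕ} (hf : Primrec f) (hg : Primrec g) :
    Primrec fun x => f x + g x :=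
  Primrec.nat_add.comp hf hg

@[fun_prop]
theorem fun_nat_sub {f g : α → ℕ} (hf : Primrec f) (hg : Primrec g) :
    Primrec fun x => f x - g x :=
  Primrec.nat_sub.comp hf hg

@[fun_prop]
theorem fun_nat_mul {f g : α → ℕ} (hf : Primrec f) (hg : Primrec g) :
    Primrec fun x => f x * g x :=
  Primrec.nat_mul.comp hf hg

@[fun_prop]
theorem fun_nat_pow {f g : α → ℕ} (hf : Primrec f) (hg : Primrec g) :
    Primrec fun x => f x ^ g x :=
  (Primrec₂.unpaired'.1 Nat.Primrec.pow).comp hf hg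

@[fun_prop]
theorem fun_nat_div {f g : α → ℕ} (hf : Primrec f) (hg : Primrec g) :
    Primrec fun x => f x / g x :=
  Primrec.nat_div.comp hf hg

@[fun_prop]
theorem fun_nat_mod {f g : α → ℕ} (hf : Primrec f) (hg : Primrec g) :
    Primrec fun x => f x % g x :=
  Primrec.nat_mod.comp hf hg

end Primrec

namespace PrimrecPred

@[fun_prop]
theorem fun_eq {f g : α → β} (hf : Primrec f) (hg : Primrec g) : PrimrecPred fun x => f x = g x :=
  Primrec.eq.comp hf hg

@[fun_prop]
theorem fun_nat_le {f g : α → ℕ} (hf : Primrec f) (hg : Primrec g) :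
    PrimrecPred fun x => f x ≤ g x :=
  Primrec.nat_le.comp hf hg

@[fun_prop]
theorem fun_nat_lt {f g : α → ℕ} (hf : Primrec f) (hg : Primrec g) :
    PrimrecPred fun x => f x < g x :=
  Primrec.nat_lt.comp hf hg

@[fun_prop]
theorem fun_mem {f : α → β} {g : α → List β} (hf : Primrec f) (hg : Primrec g) :
    PrimrecPred fun x => f x ∈ g x :=
  ((PrimrecRel.exists_mem_list (Primrec.eq (α := β))).comp hg hf).of_eq fun x => by simp

theorem forall_mem {p : β → α → Prop} {l : α → List β} (hp : PrimrecPred fun q : β × α => p q.1 q.2)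
    (hl : Primrec l) : PrimrecPred fun a => ∀ b ∈ l a, p b a :=
  (PrimrecRel.forall_mem_list hp.primrecRel).comp hl Primrec.id

end PrimrecPred

/-! ### Integer arithmetic is primitive recursive -/

/-- Even codes stand for nonnegative integers and odd codes for negative ones. With this explicit
form, primitive recursion on integers reduces to arithmetic on codes. -/
theorem Denumerable.ofNat_int (n : ℕ) :
    Denumerable.ofNat ℤ n = if n % 2 = 0 then ((n / 2 : ℕ) : ℤ) else -((n / 2 : ℕ) : ℤ) - 1 := by
  have h : Denumerable.ofNat ℤ n = Equiv.intEquivNat.symm n := rfl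
  rw [h]
  simp only [Equiv.intEquivNat, Equiv.natSumNatEquivNat, Equiv.intEquivNatSumNat,
    Equiv.boolProdNatEquivNat, Equiv.symm_trans_apply, Equiv.symm_symm, Equiv.coe_fn_symm_mk,
    Equiv.boolProdEquivSum_apply, Nat.mod_two_of_bodd, Nat.div2_val]
  cases n.bodd
  · simp
  · simp [Int.negSucc_eq]
    ring

theorem encode_int (n : ℤ) : encode n = if 0 ≤ n then 2 * n.toNat else 2 * (-n).toNat - 1 := by
  have h : encode n = Equiv.intEquivNat n := rfl
  rw [h]
  cases n with
  | ofNat n =>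
    simp [Equiv.intEquivNat, Equiv.natSumNatEquivNat, Equiv.intEquivNatSumNat,
      Equiv.boolProdNatEquivNat]
    rfl
  | negSucc n =>
    simp [Equiv.intEquivNat, Equiv.natSumNatEquivNat, Equiv.intEquivNatSumNat,
      Equiv.boolProdNatEquivNat]
    omega

namespace Primrec

theorem int_toNat : Primrec Int.toNat := by
  refine Primrec.ofNat_iff.2 (Primrec.of_eq (f := fun n => if n % 2 = 0 then n / 2 else 0)
    (Primrec.ite (by fun_prop) (by fun_prop) (by fun_prop)) fun n => ?_)
  rw [Denumerable.ofNat_int]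
  split_ifs <;> omega

theorem int_neg_toNat : Primrec fun z : ℤ => (-z).toNat := by
  refine Primrec.ofNat_iff.2 (Primrec.of_eq (f := fun n => if n % 2 = 0 then 0 else n / 2 + 1)
    (Primrec.ite (by fun_prop) (by fun_prop) (by fun_prop)) fun n => ?_)
  rw [Denumerable.ofNat_int]
  split_ifs <;> omega

-- The only integer-valued operation checked on codes. The others are differences of naturals built
-- from the positive part `z.toNat` and the negative part `(-z).toNat`.
@[fun_prop]
theorem fun_int_sub_nat {f g : α → ℕ} (hf : Primrec f) (hg : Primrec g) :
    Primrec fun x => (f x : ℤ) - (g x : ℤ) := by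
  refine Primrec.encode_iff.1 (Primrec.of_eq
    (f := fun x => if g x ≤ f x then 2 * (f x - g x) else 2 * (g x - f x) - 1)
    (Primrec.ite (by fun_prop) (by fun_prop) (by fun_prop)) fun x => ?_)
  rw [encode_int]
  split_ifs <;> omega

@[fun_prop]
theorem fun_int_toNat {f : α → ℤ} (hf : Primrec f) : Primrec fun x => (f x).toNat :=
  int_toNat.comp hf

@[fun_prop]
theorem fun_int_cast {f : α → ℕ} (hf : Primrec f) : Primrec fun x => (f x : ℤ) :=
  (fun_int_sub_nat hf (Primrec.const 0)).of_eq fun x => by simp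

@[fun_prop]
theorem fun_int_neg {f : α → ℤ} (hf : Primrec f) : Primrec fun x => -f x :=
  (fun_int_sub_nat (int_neg_toNat.comp hf) (int_toNat.comp hf)).of_eq fun x => by omega

@[fun_prop]
theorem fun_int_abs {f : α → ℤ} (hf : Primrec f) : Primrec fun x => |f x| :=
  (fun_int_cast (fun_nat_add (int_neg_toNat.comp hf) (int_toNat.comp hf))).of_eq fun x => by
    rcases abs_cases (f x) with h | h <;> omega

@[fun_prop]
theorem fun_int_add {f g : α → ℤ} (hf : Primrec f) (hg : Primrec g) :
    Primrec fun x => f x + g x :=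
  (fun_int_sub_nat (fun_nat_add (int_toNat.comp hf) (int_toNat.comp hg))
    (fun_nat_add (int_neg_toNat.comp hf) (int_neg_toNat.comp hg))).of_eq fun x => by omega

@[fun_prop]
theorem fun_int_mul {f g : α → ℤ} (hf : Primrec f) (hg : Primrec g) :
    Primrec fun x => f x * g x := by
  have h1 := int_toNat.comp hf
  have h2 := int_toNat.comp hg
  have h3 := int_neg_toNat.comp hf
  have h4 := int_neg_toNat.comp hg
  refine (fun_int_sub_nat (fun_nat_add (fun_nat_mul h1 h2) (fun_nat_mul h3 h4))
    (fun_nat_add (fun_nat_mul h1 h4) (fun_nat_mul h3 h2))).of_eq fun x => ?_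
  have ef : f x = (f x).toNat - (-f x).toNat := by omega
  have eg : g x = (g x).toNat - (-g x).toNat := by omega
  conv_rhs => rw [ef, eg]
  push_cast
  ring

end Primrec

namespace PrimrecPred

@[fun_prop]
theorem fun_int_lt {f g : α → ℤ} (hf : Primrec f) (hg : Primrec g) :
    PrimrecPred fun x => f x < g x :=
  PrimrecPred.of_eq (p := fun x => 0 < (g x + -f x).toNat) (by fun_prop) fun x => by omega

@[fun_prop]
theorem fun_int_le {f g : α → ℤ} (hf : Primrec f) (hg : Primrec g) :
    PrimrecPred fun x => f x ≤ g x :=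
  PrimrecPred.of_eq (p := fun x => (f x + -g x).toNat = 0) (by fun_prop) fun x => by omega

end PrimrecPred

end PrimrecFunProp

/-! ### Semidecidable predicates and inductive definitions -/

section SemiDec

variable {α β σ : Type*} [Primcodable α] [Primcodable β] [Primcodable σ]

/-- A predicate is semidecidable if it is the projection of a primitive recursive relation. -/
def SemiDec (p : α → Prop) : Prop :=
  ∃ c : α → ℕ → Prop, PrimrecRel c ∧ ∀ a, p a ↔ ∃ n, c a n

namespace SemiDec

theorem of_eq {p q : α → Prop} (hp : SemiDec p) (H : ∀ a, p a ↔ q a) : SemiDec q := by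
  obtain ⟨c, hc, h⟩ := hp
  exact ⟨c, hc, fun a => (H a).symm.trans (h a)⟩

theorem of_primrecPred {p : α → Prop} (hp : PrimrecPred p) : SemiDec p :=
  ⟨fun a _ => p a, hp.comp Primrec.fst, fun a => by simp⟩

theorem and {p q : α → Prop} (hp : SemiDec p) (hq : SemiDec q) : SemiDec fun a => p a ∧ q a := by
  obtain ⟨c, hc, h⟩ := hp
  obtain ⟨d, hd, h'⟩ := hq
  refine ⟨fun a n => c a n.unpair.1 ∧ d a n.unpair.2, ?_, fun a => ?_⟩
  · exact PrimrecPred.and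
      (hc.comp Primrec.fst (Primrec.fst.comp (Primrec.unpair.comp Primrec.snd)))
      (hd.comp Primrec.fst (Primrec.snd.comp (Primrec.unpair.comp Primrec.snd)))
  · show p a ∧ q a ↔ _
    rw [h, h']
    constructor
    · rintro ⟨⟨m, hm⟩, n, hn⟩
      exact ⟨Nat.pair m n, by simpa using ⟨hm, hn⟩⟩
    · rintro ⟨n, hn⟩
      exact ⟨⟨_, hn.1⟩, _, hn.2⟩

theorem or {p q : α → Prop} (hp : SemiDec p) (hq : SemiDec q) : SemiDec fun a => p a ∨ q a := by
  obtain ⟨c, hc, h⟩ := hp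
  obtain ⟨d, hd, h'⟩ := hq
  refine ⟨fun a n => c a n ∨ d a n, PrimrecPred.or hc hd, fun a => ?_⟩
  show p a ∨ q a ↔ _
  rw [h, h', exists_or]

theorem comp {p : β → Prop} {f : α → β} (hp : SemiDec p) (hf : Primrec f) :
    SemiDec fun a => p (f a) := by
  obtain ⟨c, hc, h⟩ := hp
  exact ⟨fun a n => c (f a) n, hc.comp (hf.comp Primrec.fst) Primrec.snd, fun a => h (f a)⟩

open Classical in
theorem exists_snd {p : α → σ → Prop} (hp : SemiDec fun q : α × σ => p q.1 q.2) :
    SemiDec fun a => ∃ s, p a s := by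
  obtain ⟨c, hc, h⟩ := hp
  refine ⟨fun a n => ((decode n.unpair.1 : Option σ).casesOn false
    fun s => decide (c (a, s) n.unpair.2) : Bool) = true, ?_, fun a => ?_⟩
  · refine PrimrecPred.fun_eq (Primrec.option_casesOn ?_ ?_ ?_) (Primrec.const true)
    · exact Primrec.decode.comp (Primrec.fst.comp (Primrec.unpair.comp Primrec.snd))
    · exact Primrec.const false
    · exact PrimrecPred.decide (p := fun q : (α × ℕ) × σ => c (q.1.1, q.2) q.1.2.unpair.2)
        (hc.comp (by fun_prop) (Primrec.snd.comp (Primrec.unpair.comp (by fun_prop))))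
  · constructor
    · rintro ⟨s, hs⟩
      obtain ⟨n, hn⟩ := (h (a, s)).1 hs
      exact ⟨Nat.pair (encode s) n, by simpa using hn⟩
    · rintro ⟨n, hn⟩
      cases hs : (decode n.unpair.1 : Option σ) with
      | none => simp [hs] at hn
      | some s => exact ⟨s, (h (a, s)).2 ⟨n.unpair.2, by simpa [hs] using hn⟩⟩

/-- A finite list of witnesses has a common strict upper bound n; searching below n for each element
of the list is primitive recursive. -/
theorem forall_mem {p : α → β → Prop} {l : α → List β}
    (hp : SemiDec fun q : α × β => p q.1 q.2) (hl : Primrec l) :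
    SemiDec fun a => ∀ b ∈ l a, p a b := by
  obtain ⟨c, hc, h⟩ := hp
  refine ⟨fun a n => ∀ b ∈ l a, ∃ k < n, c (a, b) k, ?_, fun a => ?_⟩
  · refine PrimrecPred.forall_mem (p := fun b (q : α × ℕ) => ∃ k < q.2, c (q.1, b) k)
      ?_ (hl.comp Primrec.fst)
    refine ((PrimrecRel.exists_mem_list (R := fun k (q : α × β) => c q k)
      (hc.comp Primrec.snd Primrec.fst)).comp (f := fun q : β × α × ℕ => List.range q.2.2)
      (g := fun q => (q.2.1, q.1)) (by fun_prop) (by fun_prop)).of_eq fun q => ?_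
    simp
  · constructor
    · intro H
      have H' : ∀ b ∈ l a, ∃ k, c (a, b) k := fun b hb => (h (a, b)).1 (H b hb)
      clear H
      show ∃ n, ∀ b ∈ l a, ∃ k < n, c (a, b) k
      generalize l a = L at H'
      induction L with
      | nil => exact ⟨0, by simp⟩
      | cons b L ih =>
        obtain ⟨n, hn⟩ := ih fun b hb => H' b (List.mem_cons_of_mem _ hb)
        obtain ⟨k, hk⟩ := H' b List.mem_cons_self
        refine ⟨max n (k + 1), fun b' hb' => ?_⟩
        rcases List.mem_cons.1 hb' with rfl | hb'
        · exact ⟨k, by omega, hk⟩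
        · obtain ⟨k', hk', hc'⟩ := hn b' hb'
          exact ⟨k', by omega, hc'⟩
    · rintro ⟨n, hn⟩ b hb
      obtain ⟨k, -, hk⟩ := hn b hb
      exact (h (a, b)).2 ⟨k, hk⟩

/-- The witness is a bound for the step-bounded evaluation `evaln`, which is primitive recursive. -/
theorem mem_eval : SemiDec fun q : (Nat.Partrec.Code × ℕ) × ℕ => q.2 ∈ q.1.1.eval q.1.2 := by
  refine ⟨fun q k => Nat.Partrec.Code.evaln k q.1.1 q.1.2 = some q.2, ?_, fun q => ?_⟩
  · exact PrimrecPred.fun_eq (Nat.Partrec.Code.primrec_evaln.comp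
      (g := fun q : ((Nat.Partrec.Code × ℕ) × ℕ) × ℕ => ((q.2, q.1.1.1), q.1.1.2)) (by fun_prop))
      (by fun_prop)
  · exact Nat.Partrec.Code.evaln_complete

/-- Given two semidecidable predicates, some algorithm finds one of them that holds, if there is
one. -/
theorem exists_select {p q : α → Prop} (hp : SemiDec p) (hq : SemiDec q) :
    ∃ A : α →. Bool, Partrec A ∧ ∀ a, p a ∨ q a →
      ∃ b ∈ A a, (b = true → p a) ∧ (b = false → q a) := by
  classical
  obtain ⟨c, hc, h⟩ := hp
  obtain ⟨d, hd, h'⟩ := hq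
  have hc' : Primrec₂ fun a n => decide (c a n) := PrimrecPred.decide hc
  have hd' : Primrec₂ fun a n => decide (d a n) := PrimrecPred.decide hd
  -- Both predicates are tested at the same stage n, so the search ends as soon as either has a
  -- witness, even if the other never does.
  refine ⟨fun a => Nat.rfindOpt fun n =>
    if c a n then some true else if d a n then some false else none,
    Partrec.rfindOpt (Primrec₂.to_comp ?_), fun a ha => ?_⟩
  · exact Primrec.ite hc (Primrec.const _) (Primrec.ite hd (Primrec.const _) (Primrec.const _))
  · have hdom : (Nat.rfindOpt fun n =>
        if c a n then some true else if d a n then some false else none).Dom := by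
      rw [Nat.rfindOpt_dom]
      rcases ha with ha | ha
      · obtain ⟨n, hn⟩ := (h a).1 ha
        exact ⟨n, true, by simp [hn]⟩
      · obtain ⟨n, hn⟩ := (h' a).1 ha
        by_cases hcn : c a n
        · exact ⟨n, true, by simp [hcn]⟩
        · exact ⟨n, false, by simp [hcn, hn]⟩
    refine ⟨_, Part.get_mem hdom, ?_⟩
    generalize hb : Part.get _ hdom = b
    obtain ⟨n, hn⟩ := Nat.rfindOpt_spec (hb ▸ Part.get_mem hdom)
    by_cases h1 : c a n
    · obtain rfl : b = true := by simpa [h1] using hn.symm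
      exact ⟨fun _ => (h a).2 ⟨n, h1⟩, by simp⟩
    · by_cases h2 : d a n
      · obtain rfl : b = false := by simpa [h1, h2] using hn.symm
        exact ⟨by simp, fun _ => (h' a).2 ⟨n, h2⟩⟩
      · simp [h1, h2] at hn

end SemiDec

/-- The least predicate closed under the rules `R`, where `R a l` says that `a` may be derived from
the premises `l`. -/
inductive Derivable {α : Type*} (R : α → List α → Prop) : α → Prop
  | intro {a : α} {l : List α} : R a l → (∀ b ∈ l, Derivable R b) → Derivable R a

namespace Derivable

open Classical in
/-- Add the conclusion of a rule to a list of known facts if the premises are known. -/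
noncomputable def step (c : α × List α → ℕ → Prop) (r : (α × List α) × ℕ) (S : List α) : List α :=
  if c r.1 r.2 ∧ ∀ b ∈ r.1.2, b ∈ S then r.1.1 :: S else S

open Classical in
theorem primrec_foldr_step {c : α × List α → ℕ → Prop} (hc : PrimrecRel c) :
    Primrec fun L : List ((α × List α) × ℕ) => L.foldr (step c) [] := by
  refine Primrec.list_foldr (h := fun _ q => step c q.1 q.2) Primrec.id (Primrec.const [])
    (Primrec.ite ?_ (by fun_prop) (by fun_prop))
  refine PrimrecPred.and (hc.comp (by fun_prop) (by fun_prop)) ?_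
  exact PrimrecPred.forall_mem
    (p := fun b (q : List ((α × List α) × ℕ) × ((α × List α) × ℕ) × List α) => b ∈ q.2.2)
    (by fun_prop) (by fun_prop)

/-- An inductively defined predicate with semidecidable rules is semidecidable. -/
theorem semiDec {R : α → List α → Prop} (hR : SemiDec fun q : α × List α => R q.1 q.2) :
    SemiDec (Derivable R) := by
  classical
  obtain ⟨c, hc, h⟩ := hR
  -- A list L of rule instances with their witnesses is a linearised derivation, read from its end;
  -- instances whose premises are not yet known are ignored.
  have sound : ∀ L : List ((α × List α) × ℕ), ∀ a ∈ L.foldr (step c) [], Derivable R a := by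
    intro L
    induction L with
    | nil => simp
    | cons r L ih =>
      intro a ha
      rw [List.foldr_cons, step] at ha
      split_ifs at ha with hr
      · rcases List.mem_cons.1 ha with rfl | ha
        · exact .intro ((h r.1).2 ⟨_, hr.1⟩) fun b hb => ih b (hr.2 b hb)
        · exact ih a ha
      · exact ih a ha
  have mono : ∀ r S T, S ⊆ T → step c r S ⊆ step c r T := by
    intro r S T hST
    unfold step
    split_ifs with h1 h2 h2
    · exact List.cons_subset_cons _ hST
    · exact absurd ⟨h1.1, fun b hb => hST (h1.2 b hb)⟩ h2
    · exact fun b hb => List.mem_cons_of_mem _ (hST hb)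
    · exact hST
  have grow : ∀ (L : List ((α × List α) × ℕ)) S, S ⊆ L.foldr (step c) S := by
    intro L S
    induction L with
    | nil => simp
    | cons r L ih =>
      refine List.Subset.trans ih ?_
      rw [List.foldr_cons]
      generalize L.foldr (step c) S = T
      unfold step
      split_ifs
      · exact List.subset_cons_self _ _
      · exact List.Subset.refl _
  have mono' : ∀ (L : List ((α × List α) × ℕ)) S T, S ⊆ T →
      L.foldr (step c) S ⊆ L.foldr (step c) T := by
    intro L S T hST
    induction L with
    | nil => exact hST
    | cons r L ih => exact mono _ _ _ ih
  have complete : ∀ a, Derivable R a → ∃ L : List ((α × List α) × ℕ),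
      a ∈ L.foldr (step c) [] := by
    intro a ha
    induction ha with
    | @intro a l hal hl ih =>
      -- Derivations of the several premises are concatenated: facts are never lost, and starting
      -- from more facts yields more facts.
      have : ∃ L : List ((α × List α) × ℕ), ∀ b ∈ l, b ∈ L.foldr (step c) [] := by
        clear hal hl
        induction l with
        | nil => exact ⟨[], by simp⟩
        | cons b l ihl =>
          obtain ⟨L, hL⟩ := ihl fun b hb => ih b (List.mem_cons_of_mem _ hb)
          obtain ⟨L', hL'⟩ := ih b List.mem_cons_self
          refine ⟨L ++ L', fun b' hb' => ?_⟩
          rw [List.foldr_append]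
          rcases List.mem_cons.1 hb' with rfl | hb'
          · exact grow _ _ hL'
          · exact mono' _ _ _ (List.nil_subset _) (hL b' hb')
      obtain ⟨L, hL⟩ := this
      obtain ⟨n, hn⟩ := (h (a, l)).1 hal
      refine ⟨((a, l), n) :: L, ?_⟩
      rw [List.foldr_cons, step, if_pos ⟨hn, hL⟩]
      exact List.mem_cons_self
  have : SemiDec fun a => ∃ L : List ((α × List α) × ℕ), a ∈ L.foldr (step c) [] := by
    refine SemiDec.exists_snd (p := fun a (L : List ((α × List α) × ℕ)) => a ∈ L.foldr (step c) [])
      (SemiDec.of_primrecPred ?_)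
    exact PrimrecPred.fun_mem Primrec.fst ((primrec_foldr_step hc).comp Primrec.snd)
  exact this.of_eq fun a => ⟨fun ⟨L, hL⟩ => sound L a hL, complete a⟩

end Derivable

end SemiDec

/-! ### Arithmetic of dyadic rationals -/

namespace DyadicRep

def neg (a : DyadicRep) : DyadicRep := (-a.1, a.2)

def abs (a : DyadicRep) : DyadicRep := (|a.1|, a.2)

def add (a b : DyadicRep) : DyadicRep := (a.1 * (2 ^ b.2 : ℕ) + b.1 * (2 ^ a.2 : ℕ), a.2 + b.2)

/-- Multiplication by `n / 2 ^ k`. -/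
def scale (a : DyadicRep) (n k : ℕ) : DyadicRep := (a.1 * n, a.2 + k)

def lt (a b : DyadicRep) : Prop := a.1 * (2 ^ b.2 : ℕ) < b.1 * (2 ^ a.2 : ℕ)

def le (a b : DyadicRep) : Prop := a.1 * (2 ^ b.2 : ℕ) ≤ b.1 * (2 ^ a.2 : ℕ)

theorem val_neg (a : DyadicRep) : a.neg.val = -a.val := by
  simp [neg, val, neg_div]

theorem val_abs (a : DyadicRep) : a.abs.val = |a.val| := by
  simp [abs, val, abs_div]

theorem val_add (a b : DyadicRep) : (a.add b).val = a.val + b.val := by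
  simp only [add, val]
  push_cast
  field_simp
  ring

theorem val_scale (a : DyadicRep) (n k : ℕ) : (a.scale n k).val = a.val * (n / 2 ^ k) := by
  simp only [scale, val]
  push_cast
  field_simp
  ring

theorem lt_iff (a b : DyadicRep) : a.lt b ↔ a.val < b.val := by
  rw [lt, val, val, div_lt_div_iff₀ (by positivity) (by positivity), ← Int.cast_lt (R := ℝ)]
  push_cast
  rfl

theorem le_iff (a b : DyadicRep) : a.le b ↔ a.val ≤ b.val := by
  rw [le, val, val, div_le_div_iff₀ (by positivity) (by positivity), ← Int.cast_le (R := ℝ)]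
  push_cast
  rfl

theorem val_int (n : ℤ) : val (n, 0) = n := by simp [val]

theorem val_one_div_pow (k : ℕ) : val (1, k) = ((2 : ℝ) ^ k)⁻¹ := by simp [val]

/-- Dyadic rationals are dense. -/
theorem exists_abs_sub_lt (x : ℝ) (i : ℕ) : ∃ d : DyadicRep, |d.val - x| < ((2 : ℝ) ^ i)⁻¹ := by
  refine ⟨(⌊x * 2 ^ i⌋, i), ?_⟩
  have h1 := Int.floor_le (x * 2 ^ i)
  have h2 := Int.lt_floor_add_one (x * 2 ^ i)
  have hp : (0 : ℝ) < 2 ^ i := by positivity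
  rw [val, abs_sub_lt_iff]
  constructor
  · have : (⌊x * 2 ^ i⌋ : ℝ) / 2 ^ i ≤ x := by rwa [div_le_iff₀ hp]
    have : (0 : ℝ) < (2 ^ i)⁻¹ := by positivity
    dsimp only
    linarith
  · have : x < ((⌊x * 2 ^ i⌋ : ℝ) + 1) / 2 ^ i := by rwa [lt_div_iff₀ hp]
    rw [add_div, one_div] at this
    dsimp only
    linarith

section Primrec

variable {α : Type*} [Primcodable α] {f g : α → DyadicRep}

@[fun_prop]
theorem primrec_neg (hf : Primrec f) : Primrec fun x => (f x).neg := by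
  unfold neg; fun_prop

@[fun_prop]
theorem primrec_abs (hf : Primrec f) : Primrec fun x => (f x).abs := by
  unfold abs; fun_prop

@[fun_prop]
theorem primrec_add (hf : Primrec f) (hg : Primrec g) : Primrec fun x => (f x).add (g x) := by
  unfold add; fun_prop

@[fun_prop]
theorem primrec_scale {n k : α → ℕ} (hf : Primrec f) (hn : Primrec n) (hk : Primrec k) :
    Primrec fun x => (f x).scale (n x) (k x) := by
  unfold scale; fun_prop

@[fun_prop]
theorem primrecPred_lt (hf : Primrec f) (hg : Primrec g) :
    PrimrecPred fun x => (f x).lt (g x) := by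
  unfold lt; fun_prop

@[fun_prop]
theorem primrecPred_le (hf : Primrec f) (hg : Primrec g) :
    PrimrecPred fun x => (f x).le (g x) := by
  unfold le; fun_prop

end Primrec

end DyadicRep

/-- A closed interval with dyadic midpoint and radius. -/
abbrev DyadicBall : Type := DyadicRep × DyadicRep

namespace DyadicBall

def Contains (J : DyadicBall) (y : ℝ) : Prop := |y - J.1.val| ≤ J.2.val

/-- `J` approximates the point `x` with precision `ε`. -/
def Near (J : DyadicBall) (ε : ℝ) (x : ℝ) : Prop := |J.1.val - x| < ε ∧ J.2.val < ε

/-- An interval that contains all `u + s (v - u)` with `u ∈ J`, `v ∈ J'`, `s ∈ [0, 1]` and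
`|s - k / 2 ^ K| ≤ 1 / 2 ^ K`. -/
def cell (J J' : DyadicBall) (k K : ℕ) : DyadicBall :=
  (J.1.add ((J'.1.add J.1.neg).scale k K),
    (J.2.add J'.2).add ((J'.1.add J.1.neg).abs.scale 1 K))

@[fun_prop]
theorem primrec_cell {α : Type*} [Primcodable α] {f g : α → DyadicBall} {k K : α → ℕ}
    (hf : Primrec f) (hg : Primrec g) (hk : Primrec k) (hK : Primrec K) :
    Primrec fun x => cell (f x) (g x) (k x) (K x) := by
  unfold cell; fun_prop

end DyadicBall

/-! ### Certificates -/

/-- The oracle machine `c` halts with output `d` if its queries are answered from the table `g`. -/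
inductive TableRun (c : Nat.Partrec.Code) (i : ℕ) (g : List (List DyadicRep)) :
    List (List DyadicRep) → DyadicRep → Prop
  | halt {h : List (List DyadicRep)} {d : DyadicRep} :
      encode (Sum.inr d : ℕ ⊕ DyadicRep) ∈ c.eval (encode (i, h)) → TableRun c i g h d
  | query {h : List (List DyadicRep)} {q : ℕ} {a : List DyadicRep} {d : DyadicRep} :
      encode (Sum.inl q : ℕ ⊕ DyadicRep) ∈ c.eval (encode (i, h)) → g[q]? = some a →
      TableRun c i g (h ++ [a]) d → TableRun c i g h d

/-- The entries of the table `g` are the beginning of a name of every point of the box `Js`. -/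
def TableValid (g : List (List DyadicRep)) (Js : List DyadicBall) : Prop :=
  ∀ q ∈ List.range g.length, ∃ a, g[q]? = some a ∧ a.length = Js.length ∧
    ∀ j ∈ List.range Js.length, ∃ x J, a[j]? = some x ∧ Js[j]? = some J ∧
      ((x.add J.1.neg).abs.add J.2).lt (1, q)

/-- `Encloses s r B Js`: the string `s` is a sequence of terms followed by the string `r`, and on
the box `B` the values of these terms are contained in the intervals `Js`. -/
inductive Encloses (r : List Token) (B : List DyadicBall) : List Token → List DyadicBall → Prop
  | nil : Encloses r B r []
  | var {s : List Token} {Js : List DyadicBall} {i : ℕ} {J : DyadicBall} :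
      Encloses r B s Js → B[i]? = some J → Encloses r B ((0, i) :: s) (J :: Js)
  | const {s : List Token} {Js : List DyadicBall} {num : ℤ} {den : ℕ} {J : DyadicBall} :
      Encloses r B s Js → 0 < den →
      ((J.1.scale den 0).add (-num, 0)).abs.le (J.2.scale den 0) →
      Encloses r B ((1, encode (num, den)) :: s) (J :: Js)
  | neg {s : List Token} {Js : List DyadicBall} {J : DyadicBall} :
      Encloses r B s (J :: Js) → Encloses r B ((2, 0) :: s) ((J.1.neg, J.2) :: Js)
  | add {s : List Token} {Js : List DyadicBall} {J J' : DyadicBall} :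
      Encloses r B s (J :: J' :: Js) →
      Encloses r B ((3, 0) :: s) ((J.1.add J'.1, J.2.add J'.2) :: Js)
  | abs {s : List Token} {Js : List DyadicBall} {J : DyadicBall} :
      Encloses r B s (J :: Js) → Encloses r B ((4, 0) :: s) ((J.1.abs, J.2) :: Js)
  | app {s : List Token} {Is Js : List DyadicBall} {c : Nat.Partrec.Code} {i : ℕ}
      {g : List (List DyadicRep)} {d : DyadicRep} :
      Encloses r B s (Is ++ Js) → TableRun c i g [] d → TableValid g Is →
      Encloses r B ((5, encode (Is.length, c)) :: s) ((d, (1, i)) :: Js)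

/-- The bound on the value of an atom `t > 0` or `t ≥ 0` required by a certificate: positive if the
formula is to be proved (mode `some true`), less than `δ` if its `δ`-strengthening is to be refuted
(mode `some false`), and nothing if the formula is merely parsed (mode `none`). -/
def AtomCond (δ : ℤ × ℕ) (m : Option Bool) (J : DyadicBall) : Prop :=
  m = none ∨ (m = some true ∧ J.2.lt J.1) ∨
    (m = some false ∧ ((J.1.add J.2).scale δ.2 0).lt (δ.1, 0))

/-- In mode `m` one instance of the connective with the given tag suffices. -/
def Choice (m : Option Bool) (tag : ℕ) : Prop :=
  m = none ∨ (m = some true ∧ (tag = 9 ∨ tag = 10)) ∨ (m = some false ∧ (tag = 8 ∨ tag = 11))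

/-- When one side suffices, the other is still parsed in mode `none`, since the position of its end
in the string is needed. -/
def BinCond (m : Option Bool) (tag : ℕ) (m₁ m₂ : Option Bool) : Prop :=
  (m₁ = m ∧ m₂ = m) ∨ (Choice m tag ∧ ((m₁ = m ∧ m₂ = none) ∨ (m₁ = none ∧ m₂ = m)))

/-- The 2^K cells together cover the range; a single cell contains at least the point with parameter
k / 2^K, which lies in the range because k ≤ 2^K. In both cases `ks` is nonempty, so the body is
always parsed. -/
def QuantCond (m : Option Bool) (tag : ℕ) (ks : List ℕ) (K : ℕ) : Prop :=
  ks = List.range (2 ^ K) ∨ (Choice m tag ∧ ∃ k, k ≤ 2 ^ K ∧ ks = [k])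

/-- `Certified δ r m s B`: the string `s` is a formula followed by the string `r`, and this formula
holds on the box `B` (mode `some true`), or its `δ`-strengthening fails on the box `B`
(mode `some false`). -/
inductive Certified (δ : ℤ × ℕ) :
    List Token → Option Bool → List Token → List DyadicBall → Prop
  | atom {m : Option Bool} {tag : ℕ} {r s : List Token} {B : List DyadicBall} {J : DyadicBall} :
      (tag = 6 ∨ tag = 7) → Encloses r B s [J] → AtomCond δ m J →
      Certified δ r m ((tag, 0) :: s) B
  | bin {m m₁ m₂ : Option Bool} {tag : ℕ} {r s s' : List Token} {B : List DyadicBall} :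
      (tag = 8 ∨ tag = 9) → BinCond m tag m₁ m₂ → Certified δ s' m₁ s B →
      Certified δ r m₂ s' B → Certified δ r m ((tag, 0) :: s) B
  | quant {m : Option Bool} {tag : ℕ} {r s s' : List Token} {B : List DyadicBall}
      {J J' : DyadicBall} {ks : List ℕ} {K : ℕ} :
      (tag = 10 ∨ tag = 11) → QuantCond m tag ks K → Encloses s' B s [J, J'] →
      (∀ k ∈ ks, Certified δ r m s' (B ++ [J.cell J' k K])) →
      Certified δ r m ((tag, 0) :: s) B

/-! ### Certificates can be searched for -/

section

variable {α ω : Type*} [Primcodable α] [Primcodable ω]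

/-- The relation between conclusions and premises given by a rule scheme is semidecidable. -/
theorem SemiDec.rule {concl : ω → α} {prem : ω → List α} {cond : ω → Prop} (hc : Primrec concl)
    (hp : Primrec prem) (hcond : SemiDec cond) :
    SemiDec fun q : α × List α => ∃ w, q.1 = concl w ∧ q.2 = prem w ∧ cond w := by
  refine SemiDec.exists_snd (p := fun (q : α × List α) w => q.1 = concl w ∧ q.2 = prem w ∧ cond w) ?_
  have h1 : SemiDec fun q : (α × List α) × ω => q.1.1 = concl q.2 ∧ q.1.2 = prem q.2 :=
    .of_primrecPred (.and (.fun_eq (by fun_prop) (hc.comp (by fun_prop)))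
      (.fun_eq (by fun_prop) (hp.comp (by fun_prop))))
  exact (h1.and (hcond.comp Primrec.snd)).of_eq fun q => and_assoc

end

abbrev TableRunGoal : Type :=
  (Nat.Partrec.Code × ℕ × List (List DyadicRep)) × List (List DyadicRep) × DyadicRep

theorem TableRun.semiDec :
    SemiDec fun q : (Nat.Partrec.Code × ℕ × List (List DyadicRep)) ×
      List (List DyadicRep) × DyadicRep => TableRun q.1.1 q.1.2.1 q.1.2.2 q.2.1 q.2.2 := by
  let R : TableRunGoal → List TableRunGoal → Prop := fun p l =>
    (∃ w : TableRunGoal, p = w ∧ l = [] ∧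
      encode (Sum.inr w.2.2 : ℕ ⊕ DyadicRep) ∈ w.1.1.eval (encode (w.1.2.1, w.2.1))) ∨
    ∃ w : TableRunGoal × ℕ × List DyadicRep, p = w.1 ∧ l = [(w.1.1, w.1.2.1 ++ [w.2.2], w.1.2.2)] ∧
      encode (Sum.inl w.2.1 : ℕ ⊕ DyadicRep) ∈ w.1.1.1.eval (encode (w.1.1.2.1, w.1.2.1)) ∧
      w.1.1.2.2[w.2.1]? = some w.2.2
  have hR : SemiDec fun q : TableRunGoal × List TableRunGoal => R q.1 q.2 := by
    refine SemiDec.or (SemiDec.rule (by fun_prop) (by fun_prop) ?_)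
      (SemiDec.rule (by fun_prop) (by fun_prop) ?_)
    · exact SemiDec.mem_eval.comp (f := fun w : TableRunGoal =>
        ((w.1.1, encode (w.1.2.1, w.2.1)), encode (Sum.inr w.2.2 : ℕ ⊕ DyadicRep))) (by fun_prop)
    · refine SemiDec.and ?_ (.of_primrecPred (by fun_prop))
      exact SemiDec.mem_eval.comp (f := fun w : TableRunGoal × ℕ × List DyadicRep =>
        ((w.1.1.1, encode (w.1.1.2.1, w.1.2.1)), encode (Sum.inl w.2.1 : ℕ ⊕ DyadicRep)))
        (by fun_prop)
  refine (Derivable.semiDec hR).of_eq fun p => ⟨fun h => ?_, fun h => ?_⟩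
  · induction h with
    | intro hl _ ih =>
      rcases hl with ⟨w, rfl, rfl, h⟩ | ⟨w, rfl, rfl, h, h'⟩
      · exact .halt h
      · exact .query h h' (ih _ List.mem_cons_self)
  · obtain ⟨⟨c, i, g⟩, h', d⟩ := p
    dsimp only at h
    induction h with
    | @halt h d hd => exact .intro (Or.inl ⟨((c, i, g), h, d), rfl, rfl, hd⟩) (by simp)
    | @query h q a d hq ha _ ih =>
      exact .intro (Or.inr ⟨(((c, i, g), h, d), q, a), rfl, rfl, hq, ha⟩) (by simpa using ih)

theorem TableValid.semiDec :
    SemiDec fun q : List (List DyadicRep) × List DyadicBall => TableValid q.1 q.2 := by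
  refine SemiDec.forall_mem (p := fun (p : List (List DyadicRep) × List DyadicBall) (q : ℕ) =>
    ∃ a : List DyadicRep, p.1[q]? = some a ∧ a.length = p.2.length ∧
    ∀ j ∈ List.range p.2.length, ∃ (x : DyadicRep) (J : DyadicBall), a[j]? = some x ∧ p.2[j]? = some J ∧
      ((x.add J.1.neg).abs.add J.2).lt (1, q)) ?_ (by fun_prop)
  refine SemiDec.exists_snd (p := fun (p : (List (List DyadicRep) × List DyadicBall) × ℕ)
    (a : List DyadicRep) => p.1.1[p.2]? = some a ∧ a.length = p.1.2.length ∧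
    ∀ j ∈ List.range p.1.2.length, ∃ (x : DyadicRep) (J : DyadicBall), a[j]? = some x ∧ p.1.2[j]? = some J ∧
      ((x.add J.1.neg).abs.add J.2).lt (1, p.2)) ?_
  refine .and (.of_primrecPred (by fun_prop)) (.and (.of_primrecPred (by fun_prop)) ?_)
  refine SemiDec.forall_mem
    (p := fun (p : ((List (List DyadicRep) × List DyadicBall) × ℕ) × List DyadicRep) j =>
    ∃ (x : DyadicRep) (J : DyadicBall), p.2[j]? = some x ∧ p.1.1.2[j]? = some J ∧
      ((x.add J.1.neg).abs.add J.2).lt (1, p.1.2)) ?_ (by fun_prop)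
  refine SemiDec.exists_snd
    (p := fun (p : (((List (List DyadicRep) × List DyadicBall) × ℕ) × List DyadicRep) × ℕ)
      (x : DyadicRep) =>
    ∃ J : DyadicBall, p.1.2[p.2]? = some x ∧ p.1.1.1.2[p.2]? = some J ∧
      ((x.add J.1.neg).abs.add J.2).lt (1, p.1.1.2)) ?_
  refine SemiDec.exists_snd
    (p := fun (p : ((((List (List DyadicRep) × List DyadicBall) × ℕ) × List DyadicRep) × ℕ) ×
      DyadicRep) (J : DyadicBall) => p.1.1.2[p.1.2]? = some p.2 ∧
      p.1.1.1.1.2[p.1.2]? = some J ∧ ((p.2.add J.1.neg).abs.add J.2).lt (1, p.1.1.1.2)) ?_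
  exact .of_primrecPred (by fun_prop)

abbrev EnclosesGoal : Type :=
  (List Token × List DyadicBall) × List Token × List DyadicBall

theorem Encloses.semiDec :
    SemiDec fun q : (List Token × List DyadicBall) × List Token × List DyadicBall =>
      Encloses q.1.1 q.1.2 q.2.1 q.2.2 := by
  let R : EnclosesGoal → List EnclosesGoal → Prop := fun p l =>
    -- The trivial condition `w = w` fills the slot for side conditions in rules that have none.
    (∃ w : List Token × List DyadicBall, p = (w, w.1, []) ∧ l = [] ∧ w = w) ∨
    (∃ w : EnclosesGoal × ℕ × DyadicBall, p = (w.1.1, (0, w.2.1) :: w.1.2.1, w.2.2 :: w.1.2.2) ∧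
      l = [w.1] ∧ w.1.1.2[w.2.1]? = some w.2.2) ∨
    (∃ w : EnclosesGoal × (ℤ × ℕ) × DyadicBall,
      p = (w.1.1, (1, encode w.2.1) :: w.1.2.1, w.2.2 :: w.1.2.2) ∧ l = [w.1] ∧ 0 < w.2.1.2 ∧
      ((w.2.2.1.scale w.2.1.2 0).add (-w.2.1.1, 0)).abs.le (w.2.2.2.scale w.2.1.2 0)) ∨
    (∃ w : EnclosesGoal × DyadicBall,
      p = (w.1.1, (2, 0) :: w.1.2.1, (w.2.1.neg, w.2.2) :: w.1.2.2) ∧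
      l = [(w.1.1, w.1.2.1, w.2 :: w.1.2.2)] ∧ w = w) ∨
    (∃ w : EnclosesGoal × DyadicBall × DyadicBall,
      p = (w.1.1, (3, 0) :: w.1.2.1, (w.2.1.1.add w.2.2.1, w.2.1.2.add w.2.2.2) :: w.1.2.2) ∧
      l = [(w.1.1, w.1.2.1, w.2.1 :: w.2.2 :: w.1.2.2)] ∧ w = w) ∨
    (∃ w : EnclosesGoal × DyadicBall,
      p = (w.1.1, (4, 0) :: w.1.2.1, (w.2.1.abs, w.2.2) :: w.1.2.2) ∧
      l = [(w.1.1, w.1.2.1, w.2 :: w.1.2.2)] ∧ w = w) ∨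
    (∃ w : EnclosesGoal × List DyadicBall × (Nat.Partrec.Code × ℕ × List (List DyadicRep)) × DyadicRep,
      p = (w.1.1, (5, encode (w.2.1.length, w.2.2.1.1)) :: w.1.2.1,
        (w.2.2.2, (1, w.2.2.1.2.1)) :: w.1.2.2) ∧
      l = [(w.1.1, w.1.2.1, w.2.1 ++ w.1.2.2)] ∧
      TableRun w.2.2.1.1 w.2.2.1.2.1 w.2.2.1.2.2 [] w.2.2.2 ∧ TableValid w.2.2.1.2.2 w.2.1)
  have hR : SemiDec fun q : EnclosesGoal × List EnclosesGoal => R q.1 q.2 := by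
    refine .or (.rule (by fun_prop) (by fun_prop) (.of_primrecPred (by fun_prop))) <|
      .or (.rule (by fun_prop) (by fun_prop) (.of_primrecPred (by fun_prop))) <|
      .or (.rule (by fun_prop) (by fun_prop) (.of_primrecPred (by fun_prop))) <|
      .or (.rule (by fun_prop) (by fun_prop) (.of_primrecPred (by fun_prop))) <|
      .or (.rule (by fun_prop) (by fun_prop) (.of_primrecPred (by fun_prop))) <|
      .or (.rule (by fun_prop) (by fun_prop) (.of_primrecPred (by fun_prop))) <|
      .rule (by fun_prop) (by fun_prop) (.and ?_ ?_)
    · exact TableRun.semiDec.comp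
        (f := fun w : EnclosesGoal × List DyadicBall × (Nat.Partrec.Code × ℕ × List (List DyadicRep)) ×
          DyadicRep => (w.2.2.1, ([] : List (List DyadicRep)), w.2.2.2)) (by fun_prop)
    · exact TableValid.semiDec.comp
        (f := fun w : EnclosesGoal × List DyadicBall × (Nat.Partrec.Code × ℕ × List (List DyadicRep)) ×
          DyadicRep => (w.2.2.1.2.2, w.2.1)) (by fun_prop)
  refine (Derivable.semiDec hR).of_eq fun p => ⟨fun h => ?_, fun h => ?_⟩
  · induction h with
    | intro hl _ ih =>
      rcases hl with ⟨w, rfl, rfl, -⟩ | ⟨w, rfl, rfl, h⟩ | ⟨w, rfl, rfl, h, h'⟩ | ⟨w, rfl, rfl, -⟩ |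
        ⟨w, rfl, rfl, -⟩ | ⟨w, rfl, rfl, -⟩ | ⟨w, rfl, rfl, h, h'⟩
      · exact .nil
      · exact .var (ih _ List.mem_cons_self) h
      · exact .const (ih _ List.mem_cons_self) h h'
      · exact .neg (ih _ List.mem_cons_self)
      · exact .add (ih _ List.mem_cons_self)
      · exact .abs (ih _ List.mem_cons_self)
      · exact .app (ih _ List.mem_cons_self) h h'
  · obtain ⟨⟨r, B⟩, s, Js⟩ := p
    dsimp only at h
    induction h with
    | nil => exact .intro (.inl ⟨(r, B), rfl, rfl, rfl⟩) (by simp)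
    | @var s Js i J _ h ih =>
      exact .intro (.inr <| .inl ⟨(((r, B), s, Js), i, J), rfl, rfl, h⟩) (by simpa using ih)
    | @const s Js num den J _ h h' ih =>
      exact .intro (.inr <| .inr <| .inl ⟨(((r, B), s, Js), (num, den), J), rfl, rfl, h, h'⟩)
        (by simpa using ih)
    | @neg s Js J _ ih =>
      exact .intro (.inr <| .inr <| .inr <| .inl ⟨(((r, B), s, Js), J), rfl, rfl, rfl⟩)
        (by simpa using ih)
    | @add s Js J J' _ ih =>
      exact .intro (.inr <| .inr <| .inr <| .inr <| .inl
        ⟨(((r, B), s, Js), J, J'), rfl, rfl, rfl⟩) (by simpa using ih)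
    | @abs s Js J _ ih =>
      exact .intro (.inr <| .inr <| .inr <| .inr <| .inr <| .inl
        ⟨(((r, B), s, Js), J), rfl, rfl, rfl⟩) (by simpa using ih)
    | @app s Is Js c i g d _ h h' ih =>
      exact .intro (.inr <| .inr <| .inr <| .inr <| .inr <| .inr
        ⟨(((r, B), s, Js), Is, (c, i, g), d), rfl, rfl, h, h'⟩) (by simpa using ih)

theorem AtomCond.primrecPred :
    PrimrecPred fun q : (ℤ × ℕ) × Option Bool × DyadicBall => AtomCond q.1 q.2.1 q.2.2 := by
  unfold AtomCond; fun_prop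

theorem Choice.primrecPred : PrimrecPred fun q : Option Bool × ℕ => Choice q.1 q.2 := by
  unfold Choice; fun_prop

theorem BinCond.primrecPred :
    PrimrecPred fun q : (Option Bool × ℕ) × Option Bool × Option Bool =>
      BinCond q.1.1 q.1.2 q.2.1 q.2.2 := by
  unfold BinCond Choice; fun_prop

theorem QuantCond.semiDec :
    SemiDec fun q : (Option Bool × ℕ) × List ℕ × ℕ => QuantCond q.1.1 q.1.2 q.2.1 q.2.2 := by
  refine .or (.of_primrecPred (by fun_prop)) (.and (.of_primrecPred ?_) ?_)
  · exact Choice.primrecPred.comp Primrec.fst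
  · exact SemiDec.exists_snd (p := fun (q : (Option Bool × ℕ) × List ℕ × ℕ) k =>
      k ≤ 2 ^ q.2.2 ∧ q.2.1 = [k]) (.of_primrecPred (by fun_prop))

abbrev CertifiedGoal : Type :=
  (ℤ × ℕ) × List Token × Option Bool × List Token × List DyadicBall

/-- The quantifier rule has one premise per entry of `ks`, a list of unbounded length; this is why
rules take lists of premises. -/
theorem Certified.semiDec :
    SemiDec fun q : (ℤ × ℕ) × List Token × Option Bool × List Token × List DyadicBall =>
      Certified q.1 q.2.1 q.2.2.1 q.2.2.2.1 q.2.2.2.2 := by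
  let R : CertifiedGoal → List CertifiedGoal → Prop := fun p l =>
    (∃ w : CertifiedGoal × ℕ × DyadicBall,
      p = (w.1.1, w.1.2.1, w.1.2.2.1, (w.2.1, 0) :: w.1.2.2.2.1, w.1.2.2.2.2) ∧ l = [] ∧
      (w.2.1 = 6 ∨ w.2.1 = 7) ∧ Encloses w.1.2.1 w.1.2.2.2.2 w.1.2.2.2.1 [w.2.2] ∧
      AtomCond w.1.1 w.1.2.2.1 w.2.2) ∨
    (∃ w : CertifiedGoal × ℕ × (Option Bool × Option Bool) × List Token,
      p = (w.1.1, w.1.2.1, w.1.2.2.1, (w.2.1, 0) :: w.1.2.2.2.1, w.1.2.2.2.2) ∧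
      l = [(w.1.1, w.2.2.2, w.2.2.1.1, w.1.2.2.2.1, w.1.2.2.2.2),
        (w.1.1, w.1.2.1, w.2.2.1.2, w.2.2.2, w.1.2.2.2.2)] ∧
      (w.2.1 = 8 ∨ w.2.1 = 9) ∧ BinCond w.1.2.2.1 w.2.1 w.2.2.1.1 w.2.2.1.2) ∨
    (∃ w : CertifiedGoal × ℕ × (List ℕ × ℕ) × List Token × (DyadicBall × DyadicBall),
      p = (w.1.1, w.1.2.1, w.1.2.2.1, (w.2.1, 0) :: w.1.2.2.2.1, w.1.2.2.2.2) ∧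
      l = w.2.2.1.1.map (fun k => (w.1.1, w.1.2.1, w.1.2.2.1, w.2.2.2.1,
        w.1.2.2.2.2 ++ [w.2.2.2.2.1.cell w.2.2.2.2.2 k w.2.2.1.2])) ∧
      (w.2.1 = 10 ∨ w.2.1 = 11) ∧ QuantCond w.1.2.2.1 w.2.1 w.2.2.1.1 w.2.2.1.2 ∧
      Encloses w.2.2.2.1 w.1.2.2.2.2 w.1.2.2.2.1 [w.2.2.2.2.1, w.2.2.2.2.2])
  have hR : SemiDec fun q : CertifiedGoal × List CertifiedGoal => R q.1 q.2 := by
    refine .or (.rule (by fun_prop) (by fun_prop) (.and (.of_primrecPred (by fun_prop))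
      (.and ?_ (.of_primrecPred ?_)))) <| .or (.rule (by fun_prop) (by fun_prop)
        (.of_primrecPred (.and (by fun_prop) ?_))) <|
        .rule (by fun_prop) ?_ (.and (.of_primrecPred (by fun_prop)) (.and ?_ ?_))
    · exact Encloses.semiDec.comp (f := fun w : CertifiedGoal × ℕ × DyadicBall =>
        ((w.1.2.1, w.1.2.2.2.2), w.1.2.2.2.1, [w.2.2])) (by fun_prop)
    · exact AtomCond.primrecPred.comp (f := fun w : CertifiedGoal × ℕ × DyadicBall =>
        (w.1.1, w.1.2.2.1, w.2.2)) (by fun_prop)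
    · exact BinCond.primrecPred.comp
        (f := fun w : CertifiedGoal × ℕ × (Option Bool × Option Bool) × List Token =>
        ((w.1.2.2.1, w.2.1), w.2.2.1.1, w.2.2.1.2)) (by fun_prop)
    · refine Primrec.list_map (f := fun w : CertifiedGoal × ℕ × (List ℕ × ℕ) × List Token ×
        (DyadicBall × DyadicBall) => w.2.2.1.1) (by fun_prop) (Primrec₂.mk ?_)
      fun_prop
    · exact QuantCond.semiDec.comp (f := fun w : CertifiedGoal × ℕ × (List ℕ × ℕ) × List Token ×
        (DyadicBall × DyadicBall) => ((w.1.2.2.1, w.2.1), w.2.2.1.1, w.2.2.1.2)) (by fun_prop)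
    · exact Encloses.semiDec.comp (f := fun w : CertifiedGoal × ℕ × (List ℕ × ℕ) × List Token ×
        (DyadicBall × DyadicBall) => ((w.2.2.2.1, w.1.2.2.2.2), w.1.2.2.2.1,
          [w.2.2.2.2.1, w.2.2.2.2.2])) (by fun_prop)
  refine (Derivable.semiDec hR).of_eq fun p => ⟨fun h => ?_, fun h => ?_⟩
  · induction h with
    | intro hl _ ih =>
      rcases hl with ⟨w, rfl, rfl, h, h', h''⟩ | ⟨w, rfl, rfl, h, h'⟩ | ⟨w, rfl, rfl, h, h', h''⟩
      · exact .atom h h' h''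
      · exact .bin h h' (ih _ List.mem_cons_self) (ih _ (List.mem_cons_of_mem _ List.mem_cons_self))
      · exact .quant h h' h'' fun k hk => ih _ (List.mem_map_of_mem hk)
  · obtain ⟨δ, r, m, s, B⟩ := p
    dsimp only at h
    induction h with
    | @atom m tag r s B J h h' h'' =>
      exact .intro (.inl ⟨((δ, r, m, s, B), tag, J), rfl, rfl, h, h', h''⟩) (by simp)
    | @bin m m₁ m₂ tag r s s' B h h' _ _ ih ih' =>
      exact .intro (.inr <| .inl ⟨((δ, r, m, s, B), tag, (m₁, m₂), s'), rfl, rfl, h, h'⟩)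
        (by simpa using ⟨ih, ih'⟩)
    | @quant m tag r s s' B J J' ks K h h' h'' _ ih =>
      exact .intro (.inr <| .inr ⟨((δ, r, m, s, B), tag, (ks, K), s', J, J'), rfl, rfl, h, h', h''⟩)
        (by simpa using ih)

/-! ### Soundness of certificates -/

theorem mem_uIcc_iff_exists_add_mul {u v y : ℝ} :
    y ∈ Set.uIcc u v ↔ ∃ s : ℝ, 0 ≤ s ∧ s ≤ 1 ∧ y = u + s * (v - u) := by
  rw [← segment_eq_uIcc, segment_eq_image']
  simp only [Set.mem_image, Set.mem_Icc, smul_eq_mul, and_assoc, eq_comm]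

/-- Each action is the value of a partial function of the input and the answers so far, so a run has
no choices. -/
theorem OracleRun.unique {n : ℕ} {c : Nat.Partrec.Code} {γ : ℕ → Fin n → DyadicRep} {i : ℕ}
    {h : List (List DyadicRep)} {d d' : DyadicRep} (H : OracleRun c γ i h d)
    (H' : OracleRun c γ i h d') : d = d' := by
  induction H with
  | halt hd =>
    cases H' with
    | halt hd' => simpa using encode_injective (Part.mem_unique hd hd')
    | query hq _ => simpa using encode_injective (Part.mem_unique hd hq)
  | query hq _ ih =>
    cases H' with
    | halt hd' => simpa using encode_injective (Part.mem_unique hq hd')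
    | query hq' h' =>
      obtain rfl := Sum.inl_injective (encode_injective (Part.mem_unique hq hq'))
      exact ih h'

theorem TableRun.oracleRun {n : ℕ} {c : Nat.Partrec.Code} {γ : ℕ → Fin n → DyadicRep} {i : ℕ}
    {g h : List (List DyadicRep)} {d : DyadicRep} (H : TableRun c i g h d)
    (hg : ∀ q a, g[q]? = some a → a = List.ofFn (γ q)) : OracleRun c γ i h d := by
  induction H with
  | halt hd => exact .halt hd
  | query hq ha _ ih => exact .query hq (hg _ _ ha ▸ ih)

/-- The box `B` contains the point `x`. -/
def BoxContains {k : ℕ} (B : List DyadicBall) (x : Fin k → ℝ) : Prop :=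
  B.length = k ∧ ∀ i : Fin k, ∃ J, B[(i : ℕ)]? = some J ∧ J.Contains (x i)

theorem BoxContains.snoc {k : ℕ} {B : List DyadicBall} {x : Fin k → ℝ} (h : BoxContains B x)
    {I : DyadicBall} {y : ℝ} (hI : I.Contains y) :
    BoxContains (B ++ [I]) (Fin.snoc x y : Fin (k + 1) → ℝ) := by
  obtain ⟨hk, h⟩ := h
  refine ⟨by simp [hk], fun i => ?_⟩
  refine Fin.lastCases ?_ (fun i => ?_) i
  · exact ⟨I, by simp [← hk], by simpa using hI⟩
  · obtain ⟨J, hJ, hJx⟩ := h i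
    refine ⟨J, ?_, by simpa using hJx⟩
    rw [Fin.val_castSucc, List.getElem?_append_left (by omega)]
    exact hJ

/-- Inside the table, distance to the midpoint plus radius is below 2⁻^q, so each entry is accurate
for every point of the box. Beyond the table, arbitrary dyadic approximations of x are used. -/
theorem TableValid.exists_name {g : List (List DyadicRep)} {Js : List DyadicBall}
    (hg : TableValid g Js) {n : ℕ} {x : Fin n → ℝ} (hx : BoxContains Js x) :
    ∃ γ : ℕ → Fin n → DyadicRep, IsName γ x ∧ ∀ q a, g[q]? = some a → a = List.ofFn (γ q) := by
  obtain ⟨rfl, hx⟩ := hx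
  choose d hd using DyadicRep.exists_abs_sub_lt
  refine ⟨fun q j => if h : ∃ a, g[q]? = some a ∧ j < a.length then
    h.choose[(j : ℕ)]'h.choose_spec.2 else d (x j) q, fun q j => ?_, fun q a ha => ?_⟩
  · dsimp only
    split_ifs with h
    · obtain ⟨hgq, hj⟩ := h.choose_spec
      obtain ⟨a, ha, hlen, hval⟩ :=
        hg q (List.mem_range.2 (List.getElem?_eq_some_iff.1 hgq).choose)
      obtain ⟨y, J, hy, hJ, hlt⟩ := hval j (List.mem_range.2 j.2)
      obtain ⟨J', hJ', hJx⟩ := hx j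
      obtain rfl : J = J' := Option.some_injective _ (hJ.symm.trans hJ')
      have hca : h.choose = a := by simpa [ha] using hgq.symm
      have hyv : h.choose[(j : ℕ)] = y := by
        rw [List.getElem?_eq_some_iff] at hy
        obtain ⟨_, hy⟩ := hy
        simpa [hca] using hy
      rw [hyv]
      rw [DyadicRep.lt_iff, DyadicRep.val_add, DyadicRep.val_abs, DyadicRep.val_add,
        DyadicRep.val_neg, DyadicRep.val_one_div_pow] at hlt
      rw [DyadicBall.Contains, abs_sub_comm] at hJx
      have := abs_sub_le y.val J.1.val (x j)
      rw [← sub_eq_add_neg] at hlt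
      linarith
    · exact hd _ _
  · obtain ⟨a', ha', hlen, -⟩ := hg q (List.mem_range.2 (List.getElem?_eq_some_iff.1 ha).choose)
    obtain rfl : a = a' := by simpa [ha] using ha'
    refine List.ext_getElem (by simp [hlen]) fun j h1 h2 => ?_
    have h : ∃ a, g[q]? = some a ∧ j < a.length := ⟨a, ha, h1⟩
    have hca : h.choose = a := by simpa [ha] using h.choose_spec.1.symm
    simp only [List.getElem_ofFn]
    rw [dif_pos h]
    simp [hca]

/-- The table run is also a run on a name of x extending the table; by determinism its output is the
one that `Computes` guarantees to be accurate. -/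
theorem TableRun.sound {c : Nat.Partrec.Code} {i : ℕ} {g : List (List DyadicRep)} {d : DyadicRep}
    {Js : List DyadicBall} (H : TableRun c i g [] d) (hg : TableValid g Js) {n : ℕ}
    {D : Set (Fin n → ℝ)} {f : (Fin n → ℝ) → ℝ} (hc : Computes c D f) {x : Fin n → ℝ}
    (hxD : x ∈ D) (hx : BoxContains Js x) : |d.val - f x| < ((2 : ℝ) ^ i)⁻¹ := by
  obtain ⟨γ, hγ, hγg⟩ := hg.exists_name hx
  obtain ⟨d', hd', h⟩ := hc x hxD γ hγ i
  rwa [(H.oracleRun hγg).unique hd']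

namespace FunCollection

variable {F : FunCollection.{u}} {prog : F.Symbol → Nat.Partrec.Code}

/-- Prefix notation is read as a stack machine working from the right, so the induction needs a
whole list of terms. The conclusion `w = r` is unique readability: the certificate parses exactly
these terms. Definedness stays a premise for each point because a box may stick out of the domains.
-/
theorem _root_.Encloses.sound (hF : ∀ s, Computes (prog s) (F.dom s) (F.fn s))
    {r : List Token} {B : List DyadicBall} {s : List Token} {Js : List DyadicBall}
    (H : Encloses r B s Js) {k : ℕ} (L : List (Term F k)) (w : List Token)
    (hL : L.length = Js.length) (hs : s = (L.map (Term.code prog)).flatten ++ w) :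
    w = r ∧ ∀ x : Fin k → ℝ, BoxContains B x →
      List.Forall₂ (fun (t : Term F k) (J : DyadicBall) => t.Defined x → J.Contains (t.eval x))
        L Js := by
  induction H generalizing L with
  | nil =>
    obtain rfl := List.length_eq_zero_iff.1 hL
    exact ⟨by simpa using hs.symm, fun x _ => .nil⟩
  | @var s Js i J _ hJ ih =>
    obtain _ | ⟨t, L⟩ := L
    · simp at hL
    cases t <;> simp [Term.code] at hs
    rename_i i'
    obtain ⟨rfl, hs⟩ := hs
    obtain ⟨hw, ih⟩ := ih L (by simpa using hL) (by simpa using hs)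
    refine ⟨hw, fun x hx => .cons (fun _ => ?_) (ih x hx)⟩
    obtain ⟨J', hJ', h⟩ := hx.2 i'
    obtain rfl : J = J' := by simpa [hJ] using hJ'
    exact h
  | @const s Js num den J _ hden hJ ih =>
    obtain _ | ⟨t, L⟩ := L
    · simp at hL
    cases t <;> simp [Term.code] at hs
    rename_i q
    obtain ⟨⟨rfl, rfl⟩, hs⟩ := hs
    obtain ⟨hw, ih⟩ := ih L (by simpa using hL) (by simpa using hs)
    refine ⟨hw, fun x hx => .cons (fun _ => ?_) (ih x hx)⟩
    rw [DyadicRep.le_iff, DyadicRep.val_abs, DyadicRep.val_add, DyadicRep.val_scale,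
      DyadicRep.val_scale, DyadicRep.val_int] at hJ
    have hq : (q.num : ℝ) = q * q.den := by
      rw [← Rat.cast_natCast, ← Rat.cast_intCast, ← Rat.cast_mul, Rat.mul_den_eq_num]
    have hpos : (0 : ℝ) < q.den := by exact_mod_cast hden
    push_cast at hJ
    rw [hq, pow_zero, div_one, ← sub_eq_add_neg, ← sub_mul, abs_mul, abs_of_pos hpos] at hJ
    rw [DyadicBall.Contains, Term.eval, abs_sub_comm]
    exact le_of_mul_le_mul_right hJ hpos
  | @neg s Js J _ ih =>
    obtain _ | ⟨t, L⟩ := L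
    · simp at hL
    cases t <;> simp [Term.code] at hs
    rename_i t
    obtain ⟨hw, ih⟩ := ih (t :: L) (by simpa using hL) (by simpa using hs)
    refine ⟨hw, fun x hx => ?_⟩
    obtain ⟨h, h'⟩ := List.forall₂_cons.1 (ih x hx)
    refine .cons (fun ht => ?_) h'
    have := h ht
    rw [DyadicBall.Contains] at this ⊢
    rw [DyadicRep.val_neg, Term.eval, neg_sub_neg, abs_sub_comm]
    exact this
  | @add s Js J J' _ ih =>
    obtain _ | ⟨t, L⟩ := L
    · simp at hL
    cases t <;> simp [Term.code] at hs
    rename_i t t'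
    obtain ⟨hw, ih⟩ := ih (t :: t' :: L) (by simpa using hL) (by simpa using hs)
    refine ⟨hw, fun x hx => ?_⟩
    obtain ⟨h, h'⟩ := List.forall₂_cons.1 (ih x hx)
    obtain ⟨h', h''⟩ := List.forall₂_cons.1 h'
    refine .cons (fun ht => ?_) h''
    have h1 := h ht.1
    have h2 := h' ht.2
    rw [DyadicBall.Contains] at h1 h2 ⊢
    rw [DyadicRep.val_add, DyadicRep.val_add, Term.eval, add_sub_add_comm]
    exact (abs_add_le _ _).trans (add_le_add h1 h2)
  | @abs s Js J _ ih =>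
    obtain _ | ⟨t, L⟩ := L
    · simp at hL
    cases t <;> simp [Term.code] at hs
    rename_i t
    obtain ⟨hw, ih⟩ := ih (t :: L) (by simpa using hL) (by simpa using hs)
    refine ⟨hw, fun x hx => ?_⟩
    obtain ⟨h, h'⟩ := List.forall₂_cons.1 (ih x hx)
    refine .cons (fun ht => ?_) h'
    have := h ht
    rw [DyadicBall.Contains] at this ⊢
    rw [DyadicRep.val_abs, Term.eval]
    exact (abs_abs_sub_abs_le _ _).trans this
  | @app s Is Js c i g d _ hrun hvalid ih =>
    obtain _ | ⟨t, L⟩ := L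
    · simp at hL
    cases t <;> simp [Term.code] at hs
    rename_i f ts
    obtain ⟨⟨hlen, rfl⟩, hs⟩ := hs
    obtain ⟨hw, ih⟩ := ih (List.ofFn ts ++ L) (by simpa [hlen] using hL)
      (by simpa [List.map_ofFn, Function.comp_def] using hs)
    refine ⟨hw, fun x hx => ?_⟩
    have key := ih x hx
    have h1 := List.forall₂_take (F.arity f) key
    have h2 := List.forall₂_drop (F.arity f) key
    rw [List.take_left' (by simp), List.take_left' hlen] at h1
    rw [List.drop_left' (by simp), List.drop_left' hlen] at h2
    refine .cons (fun ht => ?_) h2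
    have hbox : BoxContains Is fun j => (ts j).eval x := by
      refine ⟨hlen, fun j => ?_⟩
      have hj : (j : ℕ) < Is.length := by omega
      refine ⟨Is[(j : ℕ)], by simp, ?_⟩
      have := h1.get (i := j) (by simp) hj
      simp only [List.get_eq_getElem, List.getElem_ofFn] at this
      exact this (ht.1 j)
    rw [DyadicBall.Contains, abs_sub_comm, DyadicRep.val_one_div_pow]
    exact (hrun.sound hvalid (hF f) ht.2 hbox).le

end FunCollection

theorem DyadicBall.cell_contains {J J' : DyadicBall} {u v s : ℝ} {k K : ℕ} (hu : J.Contains u)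
    (hv : J'.Contains v) (h0 : 0 ≤ s) (h1 : s ≤ 1) (hs : |s - k / 2 ^ K| ≤ 1 / 2 ^ K) :
    (J.cell J' k K).Contains (u + s * (v - u)) := by
  rw [Contains] at hu hv ⊢
  simp only [cell, DyadicRep.val_add, DyadicRep.val_scale, DyadicRep.val_neg, DyadicRep.val_abs]
  -- A convex combination of the two endpoint errors, plus the error from replacing s by the grid
  -- point.
  have e : u + s * (v - u) - (J.1.val + (J'.1.val + -J.1.val) * (k / 2 ^ K)) =
      (1 - s) * (u - J.1.val) + s * (v - J'.1.val) +
        (J'.1.val + -J.1.val) * (s - k / 2 ^ K) := by ring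
  rw [e]
  refine (abs_add_le _ _).trans (add_le_add ((abs_add_le _ _).trans (add_le_add ?_ ?_)) ?_)
  · rw [abs_mul, abs_of_nonneg (by linarith)]
    nlinarith [abs_nonneg (u - J.1.val)]
  · rw [abs_mul, abs_of_nonneg h0]
    nlinarith [abs_nonneg (v - J'.1.val)]
  · rw [abs_mul]
    push_cast
    exact mul_le_mul_of_nonneg_left hs (abs_nonneg _)

theorem exists_lt_two_pow_abs_sub_le {s : ℝ} (h0 : 0 ≤ s) (h1 : s ≤ 1) (K : ℕ) :
    ∃ k : ℕ, k < 2 ^ K ∧ |s - k / 2 ^ K| ≤ 1 / 2 ^ K := by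
  have hp : (0 : ℝ) < 2 ^ K := by positivity
  rcases h1.eq_or_lt with rfl | h1
  -- Rounding s = 1 down would give the excluded index 2^K; the last cell still reaches 1.
  · refine ⟨2 ^ K - 1, Nat.sub_one_lt (pow_ne_zero _ two_ne_zero), ?_⟩
    rw [Nat.cast_sub Nat.one_le_two_pow]
    push_cast
    rw [sub_div, div_self hp.ne', sub_sub_cancel, abs_of_nonneg (by positivity)]
  · have h2 : 0 ≤ s * 2 ^ K := by positivity
    refine ⟨⌊s * 2 ^ K⌋₊, ?_, ?_⟩
    · rw [Nat.floor_lt h2]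
      push_cast
      nlinarith
    · have h3 := Nat.floor_le h2
      have h4 := Nat.lt_floor_add_one (s * 2 ^ K)
      have e : s - (⌊s * 2 ^ K⌋₊ : ℝ) / 2 ^ K = (s * 2 ^ K - ⌊s * 2 ^ K⌋₊) / 2 ^ K := by
        field_simp
      rw [e, abs_of_nonneg (div_nonneg (by linarith) hp.le)]
      gcongr
      linarith

theorem BinCond.eq_or_eq {m m₁ m₂ : Option Bool} {tag : ℕ} (h : BinCond m tag m₁ m₂) :
    m₁ = m ∨ m₂ = m := by
  obtain h | ⟨-, h | h⟩ := h
  exacts [.inl h.1, .inl h.1, .inr h.2]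

theorem BinCond.eq_and_eq {m m₁ m₂ : Option Bool} {tag : ℕ} (h : BinCond m tag m₁ m₂)
    (hm : ¬ Choice m tag) : m₁ = m ∧ m₂ = m :=
  h.resolve_right fun h => hm h.1

theorem QuantCond.forall_exists {m : Option Bool} {tag : ℕ} {ks : List ℕ} {K : ℕ}
    (h : QuantCond m tag ks K) (hm : ¬ Choice m tag) {J J' : DyadicBall} {u v y : ℝ}
    (hu : J.Contains u) (hv : J'.Contains v) (hy : y ∈ Set.uIcc u v) :
    ∃ k ∈ ks, (J.cell J' k K).Contains y := by
  obtain ⟨s, h0, h1, rfl⟩ := mem_uIcc_iff_exists_add_mul.1 hy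
  obtain rfl | ⟨h, -⟩ := h
  · obtain ⟨k, hk, hs⟩ := exists_lt_two_pow_abs_sub_le h0 h1 K
    exact ⟨k, List.mem_range.2 hk, DyadicBall.cell_contains hu hv h0 h1 hs⟩
  · exact absurd h hm

theorem QuantCond.exists_exists {m : Option Bool} {tag : ℕ} {ks : List ℕ} {K : ℕ}
    (h : QuantCond m tag ks K) {J J' : DyadicBall} {u v : ℝ}
    (hu : J.Contains u) (hv : J'.Contains v) :
    ∃ k ∈ ks, ∃ y ∈ Set.uIcc u v, (J.cell J' k K).Contains y := by
  obtain ⟨k, hk, hks⟩ : ∃ k : ℕ, k ∈ ks ∧ k ≤ 2 ^ K := by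
    obtain rfl | ⟨-, k, hk, rfl⟩ := h
    · exact ⟨0, by simp, by simp⟩
    · exact ⟨k, by simp, hk⟩
  have h0 : (0 : ℝ) ≤ k / 2 ^ K := by positivity
  have h1 : (k : ℝ) / 2 ^ K ≤ 1 := by
    rw [div_le_one (by positivity)]
    exact_mod_cast hks
  exact ⟨k, hk, _, mem_uIcc_iff_exists_add_mul.2 ⟨_, h0, h1, rfl⟩,
    DyadicBall.cell_contains hu hv h0 h1 (by simp)⟩

namespace FunCollection

variable {F : FunCollection.{u}} {prog : F.Symbol → Nat.Partrec.Code}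

/-- What a certificate in mode `m` asserts about a formula at a point. -/
def Formula.Meets (δ : ℚ) (m : Option Bool) {k : ℕ} (φ : Formula F k) (x : Fin k → ℝ) : Prop :=
  (m = some true → φ.Holds x) ∧ (m = some false → ¬ (φ.strengthen δ).Holds x)

theorem _root_.AtomCond.sound {δ : ℚ} {m : Option Bool} {J : DyadicBall}
    (h : AtomCond (δ.num, δ.den) m J) {y : ℝ} (hy : J.Contains y) :
    (m = some true → 0 < y) ∧ (m = some false → y < δ) := by
  rw [DyadicBall.Contains, abs_sub_le_iff] at hy
  constructor
  · rintro rfl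
    simp only [AtomCond, reduceCtorEq, false_or, true_and, Option.some.injEq, false_and,
      Bool.true_eq_false, or_false, DyadicRep.lt_iff] at h
    linarith
  · rintro rfl
    simp only [AtomCond, reduceCtorEq, false_or, true_and, Option.some.injEq, false_and,
      Bool.false_eq_true, DyadicRep.lt_iff, DyadicRep.val_scale, DyadicRep.val_int,
      DyadicRep.val_add, pow_zero, div_one] at h
    have hq : (δ.num : ℝ) = δ * δ.den := by
      rw [← Rat.cast_natCast, ← Rat.cast_intCast, ← Rat.cast_mul, Rat.mul_den_eq_num]
    have hpos : (0 : ℝ) < δ.den := by exact_mod_cast δ.den_pos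
    rw [hq] at h
    have := lt_of_mul_lt_mul_right h hpos.le
    linarith

/-- The parsing claim `w = r` is proved together with the semantic one: it identifies the
intermediate remainder s' with the code of the next subformula, so that the induction hypotheses
apply. -/
theorem _root_.Certified.sound (hF : ∀ s, Computes (prog s) (F.dom s) (F.fn s)) {δ : ℚ}
    {r : List Token} {m : Option Bool} {B : List DyadicBall} {s : List Token}
    (H : Certified (δ.num, δ.den) r m s B) {k : ℕ} (φ : Formula F k) (w : List Token)
    (hs : s = φ.code prog ++ w) :
    w = r ∧ ∀ x : Fin k → ℝ, BoxContains B x → φ.Defined x → φ.Meets δ m x := by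
  induction H generalizing k w with
  | @atom m tag r s B J ht hJ hm =>
    have key : ∀ t : Term F k, s = t.code prog ++ w → w = r ∧ ∀ x : Fin k → ℝ, BoxContains B x →
        t.Defined x → J.Contains (t.eval x) := by
      intro t ht
      obtain ⟨hw, h⟩ := hJ.sound hF [t] w (by simp) (by simpa using ht)
      exact ⟨hw, fun x hx => (List.forall₂_cons.1 (h x hx)).1⟩
    cases φ <;> simp [Formula.code] at hs
    -- Formulas whose leading tag differs from the one in the rule are impossible.
    all_goals try (exfalso; have := hs.1; omega)
    · obtain ⟨hw, h⟩ := key _ hs.2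
      refine ⟨hw, fun x hx ht => ?_⟩
      obtain ⟨h1, h2⟩ := hm.sound (h x hx ht)
      refine ⟨h1, fun hm => ?_⟩
      have := h2 hm
      simp only [Formula.strengthen, Formula.Holds, Term.eval]
      linarith
    · obtain ⟨hw, h⟩ := key _ hs.2
      refine ⟨hw, fun x hx ht => ?_⟩
      obtain ⟨h1, h2⟩ := hm.sound (h x hx ht)
      refine ⟨fun hm => (h1 hm).le, fun hm => ?_⟩
      have := h2 hm
      simp only [Formula.strengthen, Formula.Holds, Term.eval]
      linarith
  | @bin m m₁ m₂ tag r s s' B ht hm _ _ ih ih' =>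
    cases φ <;> simp [Formula.code] at hs
    all_goals try (exfalso; have := hs.1; omega)
    all_goals
      rename_i φ ψ
      obtain ⟨rfl, hs⟩ := hs
      obtain ⟨hw, h⟩ := ih φ _ hs
      obtain ⟨hw', h'⟩ := ih' ψ _ hw.symm
      refine ⟨hw', fun x hx ⟨hd, hd'⟩ => ?_⟩
      obtain ⟨h1, h2⟩ := h x hx hd
      obtain ⟨h3, h4⟩ := h' x hx hd'
      simp only [Formula.Meets, Formula.Holds, Formula.strengthen]
      constructor
      · rintro rfl
        first
        | exact hm.eq_or_eq.imp h1 h3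
        | exact (hm.eq_and_eq (by simp [Choice])).imp h1 h3
      · rintro rfl
        first
        | exact fun H => hm.eq_or_eq.elim (fun e => h2 e H.1) fun e => h4 e H.2
        | exact fun H => H.elim (h2 (hm.eq_and_eq (by simp [Choice])).1)
            (h4 (hm.eq_and_eq (by simp [Choice])).2)
  | @quant m tag r s s' B J J' ks K ht hm hJ _ ih =>
    cases φ <;> simp [Formula.code] at hs
    all_goals try (exfalso; have := hs.1; omega)
    all_goals
      rename_i u v φ
      obtain ⟨rfl, hs⟩ := hs
      obtain ⟨hw, h⟩ := hJ.sound hF [u, v] (φ.code prog ++ w) (by simp) (by simpa using hs)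
      -- Any one premise already shows how the body is parsed.
      obtain ⟨k₀, hk₀⟩ : ∃ k, k ∈ ks := by
        obtain rfl | ⟨-, k, -, rfl⟩ := hm
        · exact ⟨0, by simp⟩
        · exact ⟨k, by simp⟩
      refine ⟨(ih k₀ hk₀ φ w hw.symm).1, fun x hx ⟨hu, hv, hd⟩ => ?_⟩
      obtain ⟨h1, h2⟩ := List.forall₂_cons.1 (h x hx)
      replace h1 := h1 hu
      replace h2 := (List.forall₂_cons.1 h2).1 hv
      have key : ∀ k ∈ ks, ∀ y ∈ Set.uIcc (u.eval x) (v.eval x), (J.cell J' k K).Contains y →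
          φ.Meets δ m (Fin.snoc x y) := fun k hk y hy hc =>
        (ih k hk φ w hw.symm).2 _ (hx.snoc hc) (hd y hy)
      obtain ⟨k, hk, y, hy, hc⟩ := hm.exists_exists h1 h2
      have hex := key k hk y hy hc
      have hall : ¬ Choice m _ → ∀ y ∈ Set.uIcc (u.eval x) (v.eval x),
          φ.Meets δ m (Fin.snoc x y) := fun hm' y hy => by
        obtain ⟨k, hk, hc⟩ := hm.forall_exists hm' h1 h2 hy
        exact key k hk y hy hc
      simp only [Formula.Meets, Formula.Holds, Formula.strengthen]
      constructor
      · rintro rfl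
        first
        | exact ⟨y, hy, hex.1 rfl⟩
        | exact fun y hy => (hall (by simp [Choice]) y hy).1 rfl
      · rintro rfl
        first
        | exact fun H => hex.2 rfl (H y hy)
        | exact fun ⟨y, hy, H⟩ => (hall (by simp [Choice]) y hy).2 rfl H

end FunCollection

/-! ### Completeness of certificates -/

section Completeness

open Filter Topology

theorem DyadicBall.Near.mono {J : DyadicBall} {ε ε' x : ℝ} (h : J.Near ε x) (hε : ε ≤ ε') :
    J.Near ε' x :=
  ⟨h.1.trans_le hε, h.2.trans_le hε⟩

/-- The box `B` approximates the point `x` with precision `η`. -/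
def BoxNear {k : ℕ} (η : ℝ) (B : List DyadicBall) (x : Fin k → ℝ) : Prop :=
  B.length = k ∧ ∀ i : Fin k, ∃ J, B[(i : ℕ)]? = some J ∧ J.Near η (x i)

theorem BoxNear.snoc {k : ℕ} {η : ℝ} {B : List DyadicBall} {x : Fin k → ℝ} (h : BoxNear η B x)
    {I : DyadicBall} {y : ℝ} (hI : I.Near η y) :
    BoxNear η (B ++ [I]) (Fin.snoc x y : Fin (k + 1) → ℝ) := by
  obtain ⟨hk, h⟩ := h
  refine ⟨by simp [hk], fun i => ?_⟩
  refine Fin.lastCases ?_ (fun i => ?_) i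
  · exact ⟨I, by simp [← hk], by simpa using hI⟩
  · obtain ⟨J, hJ, hJx⟩ := h i
    refine ⟨J, ?_, by simpa using hJx⟩
    rw [Fin.val_castSucc, List.getElem?_append_left (by omega)]
    exact hJ

theorem BoxNear.mono {k : ℕ} {η η' : ℝ} {B : List DyadicBall} {x : Fin k → ℝ}
    (h : BoxNear η B x) (hη : η ≤ η') : BoxNear η' B x :=
  ⟨h.1, fun i => (h.2 i).imp fun _ hJ => ⟨hJ.1, hJ.2.mono hη⟩⟩

theorem exists_inv_two_pow_lt {ε : ℝ} (hε : 0 < ε) : ∃ i : ℕ, ((2 : ℝ) ^ i)⁻¹ < ε := by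
  obtain ⟨i, hi⟩ := exists_pow_lt_of_lt_one hε (by norm_num : (2⁻¹ : ℝ) < 1)
  exact ⟨i, by rwa [inv_pow] at hi⟩

theorem eventually_lt_nhdsGT_zero {ε : ℝ} (hε : 0 < ε) : ∀ᶠ η in 𝓝[>] (0 : ℝ), η < ε :=
  Filter.mem_of_superset (Ioo_mem_nhdsGT hε) fun _ h => h.2

/-- A halting oracle machine reads only a finite part of the oracle. -/
theorem OracleRun.exists_tableRun {n : ℕ} {c : Nat.Partrec.Code} {γ : ℕ → Fin n → DyadicRep}
    {i : ℕ} {h : List (List DyadicRep)} {d : DyadicRep} (H : OracleRun c γ i h d) :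
    ∃ N, ∀ M, N ≤ M → TableRun c i ((List.range M).map fun q => List.ofFn (γ q)) h d := by
  induction H with
  | halt hd => exact ⟨0, fun _ _ => .halt hd⟩
  | @query h q d hq _ ih =>
    obtain ⟨N, hN⟩ := ih
    refine ⟨max N (q + 1), fun M hM => .query hq ?_ (hN M (by omega))⟩
    rw [List.getElem?_map, List.getElem?_range (by omega)]
    rfl

/-- The slack 2ε pays once for the displacement of the midpoint from y and once for the radius. -/
theorem TableValid.of_near {n M : ℕ} {γ : ℕ → Fin n → DyadicRep} {y : Fin n → ℝ} {ε : ℝ}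
    (hγ : ∀ q < M, ∀ j, |(γ q j).val - y j| + 2 * ε < ((2 : ℝ) ^ q)⁻¹) {J : Fin n → DyadicBall}
    (hJ : ∀ j, (J j).Near ε (y j)) :
    TableValid ((List.range M).map fun q => List.ofFn (γ q)) (List.ofFn J) := by
  intro q hq
  replace hq : q < M := by simpa using hq
  refine ⟨List.ofFn (γ q), by simp [hq], by simp, fun j hj => ?_⟩
  replace hj : j < n := by simpa using hj
  refine ⟨γ q ⟨j, hj⟩, J ⟨j, hj⟩, by simp [hj], by simp [hj], ?_⟩
  rw [DyadicRep.lt_iff, DyadicRep.val_add, DyadicRep.val_abs, DyadicRep.val_add,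
    DyadicRep.val_neg, DyadicRep.val_one_div_pow, ← sub_eq_add_neg]
  have h1 := hγ q hq ⟨j, hj⟩
  obtain ⟨h2, h3⟩ := hJ ⟨j, hj⟩
  have h4 := abs_sub_le (γ q ⟨j, hj⟩).val (y ⟨j, hj⟩) (J ⟨j, hj⟩).1.val
  rw [abs_sub_comm (y _)] at h4
  linarith

namespace FunCollection

variable {F : FunCollection.{u}} {prog : F.Symbol → Nat.Partrec.Code}

theorem _root_.Encloses.append_args {B : List DyadicBall} {k n : ℕ} {ts : Fin n → Term F k}
    {J : Fin n → DyadicBall}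
    (h : ∀ j r s Js, Encloses r B s Js → Encloses r B ((ts j).code prog ++ s) (J j :: Js))
    {r s : List Token} {Js : List DyadicBall} (hs : Encloses r B s Js) :
    Encloses r B ((List.ofFn fun j => (ts j).code prog).flatten ++ s) (List.ofFn J ++ Js) := by
  induction n with
  | zero => simpa using hs
  | succ n ih =>
    rw [List.ofFn_succ, List.ofFn_succ, List.flatten_cons, List.append_assoc, List.cons_append]
    exact h 0 _ _ _ (ih fun j => h j.succ)

/-- The continuity of computable functions, in certificate form. Only `Near` is used, so the box
need not contain x. Quantifying over all small η lets finitely many thresholds be intersected by the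
filter. -/
theorem Term.eventually_encloses (hF : ∀ s, Computes (prog s) (F.dom s) (F.fn s)) {k : ℕ}
    (t : Term F k) (x : Fin k → ℝ) (ht : t.Defined x) {ε : ℝ} (hε : 0 < ε) :
    ∀ᶠ η in 𝓝[>] (0 : ℝ), ∀ B, BoxNear η B x → ∃ J : DyadicBall, J.Near ε (t.eval x) ∧
      ∀ r s Js, Encloses r B s Js → Encloses r B (t.code prog ++ s) (J :: Js) := by
  induction t generalizing ε with
  | var i =>
    filter_upwards [eventually_lt_nhdsGT_zero hε] with η hη B hB
    obtain ⟨J, hJ, hJx⟩ := hB.2 i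
    exact ⟨J, hJx.mono hη.le, fun r s Js h => .var h hJ⟩
  | const q =>
    refine .of_forall fun η B _ => ?_
    obtain ⟨i, hi⟩ := exists_inv_two_pow_lt hε
    obtain ⟨d, hd⟩ := DyadicRep.exists_abs_sub_lt (q : ℝ) i
    refine ⟨(d, (1, i)), ⟨hd.trans hi, by rwa [DyadicRep.val_one_div_pow]⟩, fun r s Js h =>
      .const h q.den_pos ?_⟩
    have hq : (q.num : ℝ) = q * q.den := by
      rw [← Rat.cast_natCast, ← Rat.cast_intCast, ← Rat.cast_mul, Rat.mul_den_eq_num]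
    have hpos : (0 : ℝ) < q.den := by exact_mod_cast q.den_pos
    rw [DyadicRep.le_iff, DyadicRep.val_abs, DyadicRep.val_add, DyadicRep.val_scale,
      DyadicRep.val_scale, DyadicRep.val_int, DyadicRep.val_one_div_pow]
    push_cast
    rw [hq, pow_zero, div_one, ← sub_eq_add_neg, ← sub_mul, abs_mul, abs_of_pos hpos]
    gcongr
  | neg t ih =>
    filter_upwards [ih ht hε] with η h B hB
    obtain ⟨J, hJ, h⟩ := h B hB
    refine ⟨(J.1.neg, J.2), ⟨?_, hJ.2⟩, fun r s Js hs => .neg (h r s Js hs)⟩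
    rw [DyadicRep.val_neg, Term.eval, neg_sub_neg, abs_sub_comm]
    exact hJ.1
  | add t t' ih ih' =>
    filter_upwards [ih ht.1 (half_pos hε), ih' ht.2 (half_pos hε)] with η h h' B hB
    obtain ⟨J, hJ, h⟩ := h B hB
    obtain ⟨J', hJ', h'⟩ := h' B hB
    refine ⟨(J.1.add J'.1, J.2.add J'.2), ⟨?_, ?_⟩, fun r s Js hs => ?_⟩
    · rw [DyadicRep.val_add, Term.eval, add_sub_add_comm]
      have := abs_add_le (J.1.val - t.eval x) (J'.1.val - t'.eval x)
      linarith [hJ.1, hJ'.1]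
    · rw [DyadicRep.val_add]
      linarith [hJ.2, hJ'.2]
    · rw [Term.code, List.cons_append, List.append_assoc]
      exact .add (h _ _ _ (h' _ _ _ hs))
  | abs t ih =>
    filter_upwards [ih ht hε] with η h B hB
    obtain ⟨J, hJ, h⟩ := h B hB
    refine ⟨(J.1.abs, J.2), ⟨?_, hJ.2⟩, fun r s Js hs => .abs (h r s Js hs)⟩
    rw [DyadicRep.val_abs, Term.eval]
    exact (abs_abs_sub_abs_le _ _).trans_lt hJ.1
  | app f ts ih =>
    choose d hd using DyadicRep.exists_abs_sub_lt
    obtain ⟨i, hi⟩ := exists_inv_two_pow_lt hε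
    let y : Fin (F.arity f) → ℝ := fun j => (ts j).eval x
    have hγ : IsName (fun q j => d (y j) q) y := fun q j => hd _ _
    obtain ⟨a, ha, hfa⟩ := hF f y ht.2 _ hγ i
    obtain ⟨N, hN⟩ := ha.exists_tableRun
    -- The run reads only the first N entries of the chosen name, and finitely many strict
    -- inequalities have a common slack.
    have hslack : ∀ᶠ e in 𝓝[>] (0 : ℝ), ∀ q ∈ Finset.range N, ∀ j,
        |(d (y j) q).val - y j| + 2 * e < ((2 : ℝ) ^ q)⁻¹ := by
      rw [Filter.eventually_all_finset]
      intro q _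
      rw [Filter.eventually_all]
      intro j
      have hpos : 0 < (((2 : ℝ) ^ q)⁻¹ - |(d (y j) q).val - y j|) / 2 :=
        half_pos (sub_pos.2 (hd _ _))
      filter_upwards [eventually_lt_nhdsGT_zero hpos] with e he
      linarith
    obtain ⟨e, he, hepos⟩ := (hslack.and self_mem_nhdsWithin).exists
    have hargs := Filter.eventually_all.2 fun j => ih j (ht.1 j) hepos
    filter_upwards [hargs] with η h B hB
    choose J hJ h using fun j => h j B hB
    refine ⟨(a, (1, i)), ⟨hfa.trans hi, by rwa [DyadicRep.val_one_div_pow]⟩,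
      fun r s Js hs => ?_⟩
    have key := Encloses.app (Encloses.append_args h hs) (hN N le_rfl)
      (TableValid.of_near (fun q hq => he q (Finset.mem_range.2 hq)) hJ)
    rw [List.length_ofFn] at key
    exact key

/-- A sufficient condition for the existence of a certificate in mode `m`. -/
def Formula.Strong (δ : ℚ) (m : Option Bool) : {k : ℕ} → Formula F k → (Fin k → ℝ) → Prop
  | _, pos t, x => (m = some true → 0 < t.eval x) ∧ (m = some false → t.eval x < δ)
  | _, nonneg t, x => (m = some true → 0 < t.eval x) ∧ (m = some false → t.eval x < δ)
  | _, and φ ψ, x => (Choice m 8 ∧ (φ.Strong δ m x ∨ ψ.Strong δ m x)) ∨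
      (φ.Strong δ m x ∧ ψ.Strong δ m x)
  | _, or φ ψ, x => (Choice m 9 ∧ (φ.Strong δ m x ∨ ψ.Strong δ m x)) ∨
      (φ.Strong δ m x ∧ ψ.Strong δ m x)
  | _, ex u v φ, x =>
      (Choice m 10 ∧ ∃ y ∈ Set.uIcc (u.eval x) (v.eval x), φ.Strong δ m (Fin.snoc x y)) ∨
      ∀ y ∈ Set.uIcc (u.eval x) (v.eval x), φ.Strong δ m (Fin.snoc x y)
  | _, all u v φ, x =>
      (Choice m 11 ∧ ∃ y ∈ Set.uIcc (u.eval x) (v.eval x), φ.Strong δ m (Fin.snoc x y)) ∨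
      ∀ y ∈ Set.uIcc (u.eval x) (v.eval x), φ.Strong δ m (Fin.snoc x y)

/-- Mode `none` asks nothing of atoms, so parsing can always be certified where the formula is
defined. -/
theorem Formula.strong_none (δ : ℚ) {k : ℕ} (φ : Formula F k) (x : Fin k → ℝ) :
    φ.Strong δ none x := by
  induction φ with
  | pos t => simp [Strong]
  | nonneg t => simp [Strong]
  | and φ ψ ih ih' => exact .inr ⟨ih x, ih' x⟩
  | or φ ψ ih ih' => exact .inr ⟨ih x, ih' x⟩
  | ex u v φ ih => exact .inr fun y _ => ih _
  | all u v φ ih => exact .inr fun y _ => ih _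

/-- The conditions 0 < y and y < δ cover the line, and the two modes treat ∧, ∨ and ∀, ∃ dually, so
failure of one mode forces the other. -/
theorem Formula.strong_or_strong {δ : ℚ} (hδ : 0 < δ) {k : ℕ} (φ : Formula F k)
    (x : Fin k → ℝ) : φ.Strong δ (some true) x ∨ φ.Strong δ (some false) x := by
  have hatom : ∀ y : ℝ, 0 < y ∨ y < δ := fun y =>
    (lt_or_ge 0 y).imp_right fun h => h.trans_lt (by exact_mod_cast hδ)
  induction φ with
  | pos t => simpa [Strong] using hatom (t.eval x)
  | nonneg t => simpa [Strong] using hatom (t.eval x)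
  | and φ ψ ih ih' =>
    obtain h | h := ih x
    · obtain h' | h' := ih' x
      · exact .inl (.inr ⟨h, h'⟩)
      · exact .inr (.inl ⟨by simp [Choice], .inr h'⟩)
    · exact .inr (.inl ⟨by simp [Choice], .inl h⟩)
  | or φ ψ ih ih' =>
    obtain h | h := ih x
    · exact .inl (.inl ⟨by simp [Choice], .inl h⟩)
    · obtain h' | h' := ih' x
      · exact .inl (.inl ⟨by simp [Choice], .inr h'⟩)
      · exact .inr (.inr ⟨h, h'⟩)
  | ex u v φ ih =>
    by_cases h : ∃ y ∈ Set.uIcc (u.eval x) (v.eval x), φ.Strong δ (some true) (Fin.snoc x y)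
    · exact .inl (.inl ⟨by simp [Choice], h⟩)
    · exact .inr (.inr fun y hy => (ih _).resolve_left fun hy' => h ⟨y, hy, hy'⟩)
  | all u v φ ih =>
    by_cases h : ∃ y ∈ Set.uIcc (u.eval x) (v.eval x), φ.Strong δ (some false) (Fin.snoc x y)
    · exact .inr (.inl ⟨by simp [Choice], h⟩)
    · exact .inl (.inr fun y hy => (ih _).resolve_right fun hy' => h ⟨y, hy, hy'⟩)

theorem _root_.AtomCond.exists_of_strong {δ : ℚ} {m : Option Bool} {y : ℝ}
    (h1 : m = some true → 0 < y) (h2 : m = some false → y < δ) :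
    ∃ ε > 0, ∀ J : DyadicBall, J.Near ε y → AtomCond (δ.num, δ.den) m J := by
  rcases m with _ | _ | _
  · exact ⟨1, one_pos, fun J _ => .inl rfl⟩
  -- Half the gap, because midpoint error and radius each use up ε.
  · refine ⟨(δ - y) / 2, half_pos (sub_pos.2 (h2 rfl)), fun J hJ => .inr (.inr ⟨rfl, ?_⟩)⟩
    have hq : (δ.num : ℝ) = δ * δ.den := by
      rw [← Rat.cast_natCast, ← Rat.cast_intCast, ← Rat.cast_mul, Rat.mul_den_eq_num]
    have hpos : (0 : ℝ) < δ.den := by exact_mod_cast δ.den_pos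
    rw [DyadicRep.lt_iff, DyadicRep.val_scale, DyadicRep.val_int, DyadicRep.val_add, pow_zero,
      div_one, hq]
    refine mul_lt_mul_of_pos_right ?_ hpos
    linarith [(abs_lt.1 hJ.1).2, hJ.2]
  · refine ⟨y / 2, half_pos (h1 rfl), fun J hJ => .inr (.inl ⟨rfl, ?_⟩)⟩
    rw [DyadicRep.lt_iff]
    linarith [(abs_lt.1 hJ.1).1, hJ.2]

/-- The midpoint error is a convex combination of errors below η/8. The radius is below η/8 + η/8 +
(|v - u| + η/4) / 2^K, hence below η/4 + η/2 + η/4. -/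
theorem _root_.DyadicBall.cell_near {J J' : DyadicBall} {u v η : ℝ} {k K : ℕ}
    (hu : J.Near (η / 8) u) (hv : J'.Near (η / 8) v) (hk : k ≤ 2 ^ K)
    (hK : |v - u| * ((2 : ℝ) ^ K)⁻¹ < η / 2) :
    (J.cell J' k K).Near η (u + k / 2 ^ K * (v - u)) := by
  have h0 : (0 : ℝ) ≤ k / 2 ^ K := by positivity
  have h1 : (k : ℝ) / 2 ^ K ≤ 1 := by
    rw [div_le_one (by positivity)]
    exact_mod_cast hk
  obtain ⟨hu, hu'⟩ := hu
  obtain ⟨hv, hv'⟩ := hv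
  simp only [DyadicBall.Near, DyadicBall.cell, DyadicRep.val_add, DyadicRep.val_scale,
    DyadicRep.val_neg, DyadicRep.val_abs]
  generalize (k : ℝ) / 2 ^ K = s at *
  constructor
  · have e : J.1.val + (J'.1.val + -J.1.val) * s - (u + s * (v - u)) =
        (1 - s) * (J.1.val - u) + s * (J'.1.val - v) := by ring
    rw [e]
    have h2 := abs_add_le ((1 - s) * (J.1.val - u)) (s * (J'.1.val - v))
    rw [abs_mul, abs_mul, abs_of_nonneg h0, abs_of_nonneg (by linarith : 0 ≤ 1 - s)] at h2
    nlinarith [abs_nonneg (J.1.val - u), abs_nonneg (J'.1.val - v)]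
  · have e : J'.1.val + -J.1.val = (v - u) + ((J'.1.val - v) - (J.1.val - u)) := by ring
    have h2 : |J'.1.val + -J.1.val| ≤ |v - u| + η / 4 := by
      rw [e]
      refine (abs_add_le _ _).trans (add_le_add le_rfl ((abs_sub _ _).trans ?_))
      linarith
    have hp : (0 : ℝ) < (2 ^ K)⁻¹ := by positivity
    have hp1 : ((2 : ℝ) ^ K)⁻¹ ≤ 1 := inv_le_one_of_one_le₀ (one_le_pow₀ one_le_two)
    have h3 := mul_le_mul_of_nonneg_right h2 hp.le
    have hη : 0 < η := by linarith [abs_nonneg (J.1.val - u)]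
    push_cast
    rw [one_div]
    nlinarith

/-- Uniformity over a compact set of a property that holds near each of its points. -/
theorem _root_.BoxNear.uniform {k : ℕ} {x : Fin k → ℝ} {S : Set ℝ} (hS : IsCompact S)
    {P : List DyadicBall → Prop}
    (h : ∀ y ∈ S, ∀ᶠ η in 𝓝[>] (0 : ℝ),
      ∀ B, BoxNear η B (Fin.snoc x y : Fin (k + 1) → ℝ) → P B) :
    ∃ η > 0, ∀ y ∈ S, ∀ B, BoxNear η B (Fin.snoc x y : Fin (k + 1) → ℝ) → P B := by
  refine hS.induction_on (p := fun S => ∃ η > 0, ∀ y ∈ S, ∀ B,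
    BoxNear η B (Fin.snoc x y : Fin (k + 1) → ℝ) → P B) ⟨1, one_pos, by simp⟩ ?_ ?_ ?_
  · rintro s t hst ⟨η, hη, H⟩
    exact ⟨η, hη, fun y hy => H y (hst hy)⟩
  · rintro s t ⟨η, hη, H⟩ ⟨η', hη', H'⟩
    refine ⟨min η η', lt_min hη hη', fun y hy B hB => ?_⟩
    rcases hy with hy | hy
    · exact H y hy B (hB.mono (min_le_left _ _))
    · exact H' y hy B (hB.mono (min_le_right _ _))
  · intro y hy
    obtain ⟨η, H, hη⟩ := ((h y hy).and self_mem_nhdsWithin).exists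
    replace hη : 0 < η := hη
    -- Precision η/2 around z, with z within η/2 of y, gives precision η around y.
    refine ⟨Metric.ball y (η / 2), mem_nhdsWithin_of_mem_nhds (Metric.ball_mem_nhds y (half_pos hη)),
      η / 2, half_pos hη, fun z hz B hB => H B ⟨hB.1, fun i => ?_⟩⟩
    rw [Metric.mem_ball, Real.dist_eq] at hz
    obtain ⟨J, hJ, hJ1, hJ2⟩ := hB.2 i
    refine ⟨J, hJ, ?_, by linarith⟩
    revert hJ1
    refine Fin.lastCases ?_ (fun i => ?_) i
    · simp only [Fin.snoc_last]
      intro hJ1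
      have := abs_sub_le J.1.val z y
      linarith
    · simp only [Fin.snoc_castSucc]
      intro hJ1
      linarith

/-- The mesh K and the cells are fixed from the exact endpoints at x, before the box and the
enclosures of u and v. The single cell used when one instance suffices need not contain the witness,
only approximate it. -/
theorem _root_.Certified.eventually_quant (hF : ∀ s, Computes (prog s) (F.dom s) (F.fn s))
    {δ : ℚ} {m : Option Bool} {tag : ℕ} (htag : tag = 10 ∨ tag = 11) {k : ℕ} {u v : Term F k}
    {φ : Formula F (k + 1)} {x : Fin k → ℝ} (hu : u.Defined x) (hv : v.Defined x)
    (h : (Choice m tag ∧ ∃ y ∈ Set.uIcc (u.eval x) (v.eval x), ∀ᶠ η in 𝓝[>] (0 : ℝ), ∀ B,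
        BoxNear η B (Fin.snoc x y : Fin (k + 1) → ℝ) →
          ∀ r, Certified (δ.num, δ.den) r m (φ.code prog ++ r) B) ∨
      ∀ y ∈ Set.uIcc (u.eval x) (v.eval x), ∀ᶠ η in 𝓝[>] (0 : ℝ), ∀ B,
        BoxNear η B (Fin.snoc x y : Fin (k + 1) → ℝ) →
          ∀ r, Certified (δ.num, δ.den) r m (φ.code prog ++ r) B) :
    ∀ᶠ η in 𝓝[>] (0 : ℝ), ∀ B, BoxNear η B x → ∀ r, Certified (δ.num, δ.den) r m
      ((tag, 0) :: (u.code prog ++ v.code prog ++ φ.code prog) ++ r) B := by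
  obtain ⟨η₀, hη₀, K, ks, hks, H⟩ : ∃ η₀ > 0, ∃ K ks, QuantCond m tag ks K ∧
      ∀ J J' : DyadicBall, J.Near η₀ (u.eval x) → J'.Near η₀ (v.eval x) →
        ∀ B, BoxNear η₀ B x → ∀ r, ∀ k ∈ ks,
          Certified (δ.num, δ.den) r m (φ.code prog ++ r) (B ++ [J.cell J' k K]) := by
    have hexK : ∀ ε > 0, ∃ K : ℕ, |v.eval x - u.eval x| * ((2 : ℝ) ^ K)⁻¹ < ε := by
      intro ε hε
      -- The added 1 avoids division by zero when the endpoints coincide.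
      obtain ⟨K, hK⟩ := exists_inv_two_pow_lt
        (div_pos hε (by positivity : 0 < |v.eval x - u.eval x| + 1))
      refine ⟨K, ?_⟩
      rw [lt_div_iff₀ (by positivity)] at hK
      have : (0 : ℝ) < (2 ^ K)⁻¹ := by positivity
      nlinarith
    obtain ⟨hm, y, hy, h⟩ | h := h
    · obtain ⟨η, H, hη⟩ := (h.and self_mem_nhdsWithin).exists
      replace hη : 0 < η := hη
      -- The cell lies within η/2 of the grid point, and the grid point within η/4 of the witness:
      -- together less than η.
      obtain ⟨K, hK⟩ := hexK (η / 2 / 2) (by positivity)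
      obtain ⟨s, h0, h1, rfl⟩ := mem_uIcc_iff_exists_add_mul.1 hy
      obtain ⟨k, hk, hks⟩ := exists_lt_two_pow_abs_sub_le h0 h1 K
      refine ⟨η / 2 / 8, by positivity, K, [k], .inr ⟨hm, k, hk.le, rfl⟩,
        fun J J' hJ hJ' B hB r k' hk' => H _ ((hB.mono (by linarith)).snoc ?_) r⟩
      obtain rfl := List.mem_singleton.1 hk'
      obtain ⟨hc, hc'⟩ := DyadicBall.cell_near hJ hJ' hk.le hK
      refine ⟨?_, by linarith⟩
      have h2 := abs_sub_le (J.cell J' k' K).1.val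
        (u.eval x + k' / 2 ^ K * (v.eval x - u.eval x)) (u.eval x + s * (v.eval x - u.eval x))
      have h3 : |u.eval x + k' / 2 ^ K * (v.eval x - u.eval x) -
          (u.eval x + s * (v.eval x - u.eval x))| ≤ |v.eval x - u.eval x| * ((2 : ℝ) ^ K)⁻¹ := by
        rw [add_sub_add_left_eq_sub, ← sub_mul, abs_mul, abs_sub_comm, mul_comm, ← one_div]
        exact mul_le_mul_of_nonneg_left hks (abs_nonneg _)
      linarith
    · obtain ⟨η, hη, H⟩ := BoxNear.uniform isCompact_uIcc h
      obtain ⟨K, hK⟩ := hexK (η / 2) (by positivity)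
      refine ⟨η / 8, by positivity, K, _, .inl rfl, fun J J' hJ hJ' B hB r k hk => ?_⟩
      replace hk := (List.mem_range.1 hk).le
      have h0 : (0 : ℝ) ≤ k / 2 ^ K := by positivity
      have h1 : (k : ℝ) / 2 ^ K ≤ 1 := by
        rw [div_le_one (by positivity)]
        exact_mod_cast hk
      exact H _ (mem_uIcc_iff_exists_add_mul.2 ⟨_, h0, h1, rfl⟩) _
        ((hB.mono (by linarith)).snoc (DyadicBall.cell_near hJ hJ' hk hK)) r
  filter_upwards [eventually_lt_nhdsGT_zero hη₀, u.eventually_encloses hF x hu hη₀,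
    v.eventually_encloses hF x hv hη₀] with η hη hu hv B hB r
  obtain ⟨J, hJ, hu⟩ := hu B hB
  obtain ⟨J', hJ', hv⟩ := hv B hB
  rw [List.cons_append]
  refine .quant (s' := φ.code prog ++ r) htag hks ?_ (H J J' hJ hJ' B (hB.mono hη.le) r)
  simpa using hu _ _ _ (hv _ _ _ .nil)

/-- The hypotheses range over all modes because a side that is not needed gets certified in mode
`none`. -/
theorem _root_.Certified.eventually_bin {δ : ℚ} {m : Option Bool} {tag : ℕ}
    (htag : tag = 8 ∨ tag = 9) {k : ℕ} {φ ψ : Formula F k} {x : Fin k → ℝ}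
    (hφ : ∀ m, φ.Strong δ m x → ∀ᶠ η in 𝓝[>] (0 : ℝ), ∀ B, BoxNear η B x →
      ∀ r, Certified (δ.num, δ.den) r m (φ.code prog ++ r) B)
    (hψ : ∀ m, ψ.Strong δ m x → ∀ᶠ η in 𝓝[>] (0 : ℝ), ∀ B, BoxNear η B x →
      ∀ r, Certified (δ.num, δ.den) r m (ψ.code prog ++ r) B)
    (h : (Choice m tag ∧ (φ.Strong δ m x ∨ ψ.Strong δ m x)) ∨
      (φ.Strong δ m x ∧ ψ.Strong δ m x)) :
    ∀ᶠ η in 𝓝[>] (0 : ℝ), ∀ B, BoxNear η B x → ∀ r, Certified (δ.num, δ.den) r m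
      ((tag, 0) :: (φ.code prog ++ ψ.code prog) ++ r) B := by
  obtain ⟨m₁, m₂, hm, h1, h2⟩ : ∃ m₁ m₂, BinCond m tag m₁ m₂ ∧ φ.Strong δ m₁ x ∧
      ψ.Strong δ m₂ x := by
    obtain ⟨hm, h | h⟩ | ⟨h, h'⟩ := h
    · exact ⟨m, none, .inr ⟨hm, .inl ⟨rfl, rfl⟩⟩, h, ψ.strong_none δ x⟩
    · exact ⟨none, m, .inr ⟨hm, .inr ⟨rfl, rfl⟩⟩, φ.strong_none δ x, h⟩
    · exact ⟨m, m, .inl ⟨rfl, rfl⟩, h, h'⟩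
  filter_upwards [hφ m₁ h1, hψ m₂ h2] with η hφ hψ B hB r
  rw [List.cons_append, List.append_assoc]
  exact .bin htag hm (hφ B hB _) (hψ B hB _)

theorem _root_.Certified.eventually_atom (hF : ∀ s, Computes (prog s) (F.dom s) (F.fn s))
    {δ : ℚ} {m : Option Bool} {tag : ℕ} (htag : tag = 6 ∨ tag = 7) {k : ℕ} {t : Term F k}
    {x : Fin k → ℝ} (ht : t.Defined x) (h1 : m = some true → 0 < t.eval x)
    (h2 : m = some false → t.eval x < δ) :
    ∀ᶠ η in 𝓝[>] (0 : ℝ), ∀ B, BoxNear η B x → ∀ r, Certified (δ.num, δ.den) r m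
      ((tag, 0) :: t.code prog ++ r) B := by
  obtain ⟨ε, hε, h⟩ := AtomCond.exists_of_strong h1 h2
  filter_upwards [t.eventually_encloses hF x ht hε] with η H B hB r
  obtain ⟨J, hJ, H⟩ := H B hB
  exact .atom htag (H _ _ _ .nil) (h J hJ)

theorem Formula.eventually_certified (hF : ∀ s, Computes (prog s) (F.dom s) (F.fn s)) {δ : ℚ}
    {k : ℕ} (φ : Formula F k) (x : Fin k → ℝ) (hφ : φ.Defined x) (m : Option Bool)
    (h : φ.Strong δ m x) :
    ∀ᶠ η in 𝓝[>] (0 : ℝ), ∀ B, BoxNear η B x →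
      ∀ r, Certified (δ.num, δ.den) r m (φ.code prog ++ r) B := by
  induction φ generalizing m with
  | pos t => exact Certified.eventually_atom hF (.inl rfl) hφ h.1 h.2
  | nonneg t => exact Certified.eventually_atom hF (.inr rfl) hφ h.1 h.2
  | and φ ψ ih ih' =>
    exact Certified.eventually_bin (.inl rfl) (ih x hφ.1) (ih' x hφ.2) h
  | or φ ψ ih ih' =>
    exact Certified.eventually_bin (.inr rfl) (ih x hφ.1) (ih' x hφ.2) h
  | ex u v φ ih =>
    refine Certified.eventually_quant hF (.inl rfl) hφ.1 hφ.2.1 (h.imp ?_ ?_)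
    · exact And.imp_right fun ⟨y, hy, h⟩ => ⟨y, hy, ih _ (hφ.2.2 y hy) m h⟩
    · exact fun h y hy => ih _ (hφ.2.2 y hy) m (h y hy)
  | all u v φ ih =>
    refine Certified.eventually_quant hF (.inr rfl) hφ.1 hφ.2.1 (h.imp ?_ ?_)
    · exact And.imp_right fun ⟨y, hy, h⟩ => ⟨y, hy, ih _ (hφ.2.2 y hy) m h⟩
    · exact fun h y hy => ih _ (hφ.2.2 y hy) m (h y hy)

end FunCollection

end Completeness

/-! ### The algorithm: parallel search for the two kinds of certificate -/

theorem Certified.semiDec_input (m : Option Bool) :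
    SemiDec fun q : List Token × ℤ × ℕ => Certified q.2 [] m q.1 [] :=
  Certified.semiDec.comp (f := fun q : List Token × ℤ × ℕ =>
    (q.2, ([] : List Token), m, q.1, ([] : List DyadicBall))) (by fun_prop)

theorem theorem1 :
    ∃ A : List Token × ℤ × ℕ →. Bool, Partrec A ∧
      ∀ (F : FunCollection.{u}) (prog : F.Symbol → Nat.Partrec.Code),
        (∀ s, Computes (prog s) (F.dom s) (F.fn s)) →
        ∀ φ : F.Sentence, φ.WellDefined →
        ∀ δ : ℚ, 0 < δ →
          ∃ b : Bool, b ∈ A (φ.code prog, δ.num, δ.den) ∧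
            (b = true → φ.IsTrue) ∧
            (b = false → ¬ (φ.strengthen δ).IsTrue) := by
  obtain ⟨A, hA, H⟩ := SemiDec.exists_select (Certified.semiDec_input (some true))
    (Certified.semiDec_input (some false))
  refine ⟨A, hA, fun F prog hF φ hφ δ hδ => ?_⟩
  have hbox : BoxContains [] (Fin.elim0 : Fin 0 → ℝ) := ⟨rfl, fun i => i.elim0⟩
  -- A sentence has no free variables, so the empty box is near, and contains, the only point.
  have complete : ∀ m, φ.Strong δ m Fin.elim0 →
      Certified (δ.num, δ.den) [] m (φ.code prog) [] := by
    intro m hm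
    obtain ⟨η, h⟩ := (φ.eventually_certified hF _ hφ m hm).exists
    simpa using h [] ⟨rfl, fun i => i.elim0⟩ []
  have sound : ∀ m, Certified (δ.num, δ.den) [] m (φ.code prog) [] → φ.Meets δ m Fin.elim0 :=
    fun m hm => (hm.sound hF φ [] (by simp)).2 _ hbox hφ
  obtain ⟨b, hb, h1, h2⟩ := H (φ.code prog, δ.num, δ.den)
    ((φ.strong_or_strong hδ Fin.elim0).imp (complete _) (complete _))
  exact ⟨b, hb, fun h => (sound _ (h1 h)).1 rfl, fun h => (sound _ (h2 h)).2 rfl⟩
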